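/- Let $X$ be a compact (connected) Riemann surface. A holomorphic chain $C=(E_0,\dots,E_n;\phi_1,\dots,\phi_n)$ on $X$ consists of holomorphic vector bundles $E_i$ and homomorphisms $\phi_i:E_i\to E_{i-1}$. A subchain is a chain $(F_0,\dots,F_n;\phi_1|_{F_1},\dots,\phi_n|_{F_n})$, where each $F_i\subseteq E_i$ is a subsheaf that is a vector bundle (possibly $0$) and $\phi_i(F_i)\subseteq F_{i-1}$. For $\alpha=(\alpha_1,\dots,\alpha_n)\in\mathbb R^n$ the $\alpha$-slope of a nonzero chain is $$\mu_\alpha(C)=\frac{\sum_{i=0}^n \deg E_i+\sum_{i=1}^n\alpha_i\,\mathrm{rk}\,E_i}{\sum_{i=0}^n \mathrm{rk}\,E_i},$$ and $C$ is $\alpha$-stable if $\mu_\alpha(C')<\mu_\alpha(C)$ for every subchain $C'$ of $C$ with $C'\neq 0$ and $C'\neq C$. For $i=0,\dots,n-1$ the $i$-th standard subchain of $C$ is $C_i=(E_0,\dots,E_i,0,\dots,0;\phi_1,\dots,\phi_i,0,\dots,0)$, and $H=\{\alpha\in\mathbb R^n : \mu_\alpha(C_i)<\mu_\alpha(C)\text{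 for } i=0,\dots,n-1\}$. Proposition 3.1. Let $n\ge 0$, let $C=(L_0,\dots,L_n;\phi_1,\dots,\phi_n)$ be a chain of holomorphic line bundles on $X$, and let $\alpha\in\mathbb R^n$. Then $C$ is $\alpha$-stable if and only if $\phi_i\neq 0$ for all $i=1,\dots,n$ and $\alpha\in H$. -/

import Mathlib

open Bundle Set MeasureTheory
open scoped Manifold ContDiff Laplacian

noncomputable section

namespace HolomorphicChain

universe u

/-- A holomorphic vector bundle of (constant) rank `rank` over `X`; "holomorphic" is spelled
as "complex-analytic" (`ω` over the field `ℂ`). The rank may be `0`. -/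
structure HolBundle (X : Type u) [TopologicalSpace X] [ChartedSpace ℂ X] where
  rank : ℕ
  fiber : X → Type
  [addCommGroup : ∀ x, AddCommGroup (fiber x)]
  [module : ∀ x, Module ℂ (fiber x)]
  [topologicalSpaceFiber : ∀ x, TopologicalSpace (fiber x)]
  [topologicalSpaceTotal : TopologicalSpace (TotalSpace (Fin rank → ℂ) fiber)]
  [fiberBundle : FiberBundle (Fin rank → ℂ) fiber]
  [vectorBundle : VectorBundle ℂ (Fin rank → ℂ) fiber]
  [contMDiffVectorBundle : ContMDiffVectorBundle ω (Fin rank → ℂ) fiber 𝓘(ℂ, ℂ)]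

attribute [instance] HolBundle.addCommGroup HolBundle.module HolBundle.topologicalSpaceFiber
  HolBundle.topologicalSpaceTotal HolBundle.fiberBundle HolBundle.vectorBundle
  HolBundle.contMDiffVectorBundle

section Bundles

variable {X : Type u} [TopologicalSpace X] [ChartedSpace ℂ X]

/-- The total space of a holomorphic vector bundle. -/
abbrev HolBundle.Total (E : HolBundle X) : Type u := TotalSpace (Fin E.rank → ℂ) E.fiber

/-- The standard fiber of a holomorphic vector bundle. -/
abbrev HolBundle.Model (E : HolBundle X) : Type := Fin E.rank → ℂ

/-- The zero bundle. -/
def HolBundle.zero (X : Type u) [TopologicalSpace X] [ChartedSpace ℂ X] : HolBundle X where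
  rank := 0
  fiber := Bundle.Trivial X (Fin 0 → ℂ)

/-- `s` is a holomorphic section of `E` over `U` (its values outside `U` are irrelevant). -/
def HolBundle.IsHolSection (E : HolBundle X) (U : Set X) (s : ∀ x, E.fiber x) : Prop :=
  ContMDiffOn 𝓘(ℂ, ℂ) (𝓘(ℂ, ℂ).prod 𝓘(ℂ, E.Model)) ω
    (fun x => (TotalSpace.mk x (s x) : E.Total)) U

/-- A homomorphism of holomorphic vector bundles: a family of linear maps between the fibers
which is holomorphic as a map of total spaces. -/
@[ext]
structure Hom (E F : HolBundle X) where
  toFun : ∀ x, E.fiber x →ₗ[ℂ] F.fiber x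
  holomorphic : ContMDiff (𝓘(ℂ, ℂ).prod 𝓘(ℂ, E.Model)) (𝓘(ℂ, ℂ).prod 𝓘(ℂ, F.Model)) ω
    (fun p : E.Total => (TotalSpace.mk p.1 (toFun p.1 p.2) : F.Total))

/-- The zero homomorphism. -/
instance (E F : HolBundle X) : Zero (Hom E F) where
  zero :=
    { toFun := fun _ => 0
      holomorphic := (Bundle.contMDiff_zeroSection ℂ F.fiber).comp
        (Bundle.contMDiff_proj E.fiber) }

/-- `f` is injective as a homomorphism of sheaves of holomorphic sections, so that it
exhibits (the sheaf of sections of) `E` as a subsheaf of `F`. It need not be injective on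
every fiber. -/
def Hom.IsSheafMono {E F : HolBundle X} (f : Hom E F) : Prop :=
  ∀ (U : Set X) (s : ∀ x, E.fiber x), IsOpen U → E.IsHolSection U s →
    (∀ x ∈ U, f.toFun x (s x) = 0) → ∀ x ∈ U, s x = 0

/-- `f` is an isomorphism: it has a holomorphic inverse. -/
def Hom.IsIso {E F : HolBundle X} (f : Hom E F) : Prop :=
  ∃ g : Hom F E, (∀ x v, g.toFun x (f.toFun x v) = v) ∧ (∀ x w, f.toFun x (g.toFun x w) = w)

/-- The `j`-th vector field of the holomorphic frame of `E` given by the preferred local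
trivialization around `x₀`; meaningful at the points `x` of the domain of the trivialization. -/
def HolBundle.frame (E : HolBundle X) (x₀ : X) (j : Fin E.rank) (x : X) : E.fiber x :=
  (trivializationAt E.Model E.fiber x₀).symm x (Pi.single j 1)

/-- A smooth Hermitian metric on a holomorphic vector bundle (antilinear in the first variable).
Smoothness (`C^∞` in the real sense) is the smoothness of the entries of the Gram matrices of
local holomorphic frames. -/
structure HermitianMetric (E : HolBundle X) where
  form : ∀ x, E.fiber x →ₗ⋆[ℂ] E.fiber x →ₗ[ℂ] ℂ
  conj_symm : ∀ x v w, starRingEnd ℂ (form x v w) = form x w v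
  pos : ∀ x v, v ≠ 0 → 0 < (form x v v).re
  smooth : ∀ (x₀ : X) (j k : Fin E.rank),
    ContMDiffOn 𝓘(ℝ, ℂ) 𝓘(ℝ, ℂ) ∞ (fun x => form x (E.frame x₀ j x) (E.frame x₀ k x))
      (trivializationAt E.Model E.fiber x₀).baseSet

/-- The determinant (a positive real number) of the Gram matrix at `x` of the local holomorphic
frame around `x₀`. -/
def HermitianMetric.gramDet {E : HolBundle X} (h : HermitianMetric E) (x₀ x : X) : ℝ :=
  (Matrix.det (Matrix.of fun j k => h.form x (E.frame x₀ j x) (E.frame x₀ k x))).re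

/-- The first Chern form `(i / 2π) tr Θ_h = -(i / 2π) ∂∂̄ log det h` of the Chern connection
of `h`, in the chart `z = x + i y` of `X` around `x₀`: it is `chernDensity h x₀ z dx dy`, because
`i ∂∂̄ u = (1 / 2) Δu dx dy`. -/
def HermitianMetric.chernDensity {E : HolBundle X} (h : HermitianMetric E) (x₀ : X) (z : ℂ) : ℝ :=
  -(1 / (4 * Real.pi)) *
    Laplacian.laplacian
      (fun w : ℂ => Real.log (h.gramDet x₀ ((chartAt ℂ x₀).symm w))) z

/-- The open set around `x₀` on which both the preferred chart of `X` and the preferred local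
trivialization of `E` are defined. -/
def HolBundle.patch (E : HolBundle X) (x₀ : X) : Set X :=
  (chartAt ℂ x₀).source ∩ (trivializationAt E.Model E.fiber x₀).baseSet

/-- The integral over `X` of the first Chern form of `h`, computed by means of a smooth
partition of unity `ρ`. -/
def HermitianMetric.chernNumber {E : HolBundle X} (h : HermitianMetric E)
    (ρ : SmoothPartitionOfUnity X 𝓘(ℝ, ℂ) X univ) : ℝ :=
  ∑ᶠ x₀ : X, ∫ z in (chartAt ℂ x₀).target,
    ρ x₀ ((chartAt ℂ x₀).symm z) * h.chernDensity x₀ z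

/-- The degree of a holomorphic vector bundle over a compact Riemann surface: the integral of
the first Chern form of a smooth Hermitian metric. On a compact Riemann surface a metric `h` and
a partition of unity `ρ` always exist, the value does not depend on their choice, and it is an
integer. -/
def HolBundle.degree (E : HolBundle X) : ℝ :=
  Classical.epsilon fun d : ℝ =>
    ∃ (h : HermitianMetric E) (ρ : SmoothPartitionOfUnity X 𝓘(ℝ, ℂ) X univ),
      ρ.IsSubordinate E.patch ∧ d = h.chernNumber ρ

/-- `E` if the condition `a` is true, and the zero bundle otherwise. -/
def HolBundle.trunc (E : HolBundle X) : Bool → HolBundle X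
  | true => E
  | false => HolBundle.zero X

/-- `f` if both bundles are kept, and the zero homomorphism otherwise. -/
def Hom.trunc {E F : HolBundle X} (f : Hom E F) : ∀ a b : Bool, Hom (E.trunc a) (F.trunc b)
  | true, true => f
  | true, false => 0
  | false, _ => 0

end Bundles

/-- A holomorphic chain `(E_0, …, E_n; φ_1, …, φ_n)`, `φ_i : E_i → E_{i-1}`; the homomorphism
`φ_{i+1} : E_{i+1} → E_i` is `φ i` for `i : Fin n`. -/
structure Chain (X : Type u) [TopologicalSpace X] [ChartedSpace ℂ X] (n : ℕ) where
  E : Fin (n + 1) → HolBundle X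
  φ : ∀ i : Fin n, Hom (E i.succ) (E i.castSucc)

namespace Chain

variable {X : Type u} [TopologicalSpace X] [ChartedSpace ℂ X] {n : ℕ}

/-- The `α`-slope `(∑_{i=0}^n d_i + ∑_{i=1}^n α_i r_i) / ∑_{i=0}^n r_i` for
`α = (α_1, …, α_n) ∈ ℝ^n`; the parameter `α_{i+1}` is `α i` for `i : Fin n`. -/
def slope (C : Chain X n) (α : Fin n → ℝ) : ℝ :=
  (∑ i, (C.E i).degree + ∑ i : Fin n, α i * ((C.E i.succ).rank : ℝ)) /
    ∑ i, ((C.E i).rank : ℝ)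

/-- `D` is a subchain of `C` by means of the inclusions `ι i`: the bundle `D.E i` is a subsheaf
of `C.E i`, and the homomorphisms of `D` are the restrictions of those of `C`. -/
structure IsSubchain (D C : Chain X n) (ι : ∀ i, Hom (D.E i) (C.E i)) : Prop where
  mono : ∀ i, (ι i).IsSheafMono
  comm : ∀ (i : Fin n) (x : X) (v : (D.E i.succ).fiber x),
    (ι i.castSucc).toFun x ((D.φ i).toFun x v) = (C.φ i).toFun x ((ι i.succ).toFun x v)

/-- `C` is `α`-stable: every subchain `D` which is neither zero nor all of `C` has smaller
`α`-slope. -/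
def IsStable (C : Chain X n) (α : Fin n → ℝ) : Prop :=
  ∀ (D : Chain X n) (ι : ∀ i, Hom (D.E i) (C.E i)), IsSubchain D C ι →
    (∃ i, (D.E i).rank ≠ 0) → (¬ ∀ i, (ι i).IsIso) → D.slope α < C.slope α

/-- The `i`-th standard subchain `(E_0, …, E_i, 0, …, 0; φ_1, …, φ_i, 0, …, 0)`,
`i = 0, …, n - 1`. -/
def standardSubchain (C : Chain X n) (i : Fin n) : Chain X n where
  E k := (C.E k).trunc (decide (k ≤ i.castSucc))
  φ k := (C.φ k).trunc (decide (k.succ ≤ i.castSucc)) (decide (k.castSucc ≤ i.castSucc))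

/-- The region `H` of `ℝ^n` cut out by the inequalities `μ_α(C_i) < μ_α(C)` for the standard
subchains `C_i`, `i = 0, …, n - 1`. -/
def standardCone (C : Chain X n) : Set (Fin n → ℝ) :=
  {α | ∀ i : Fin n, (C.standardSubchain i).slope α < C.slope α}

end Chain

end HolomorphicChain

end

/-!
A chain of line bundles has very few subchains up to degree, because a subsheaf of a line bundle has
rank at most one and, when it is nonzero, at most the same degree.

Suppose that all `φ i` are nonzero. A nonzero subsheaf of `L_{i+1}` is nonzero in the fibers over some
open set, and by the identity theorem `φ i` does not vanish on that set; so the support of a subchain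
`D` is an initial segment `{0, …, k}` (`Chain.IsSubchain.rank_castSucc_ne_zero`). If `k < n`, the
slope of `D` is at most that of the `k`-th standard subchain. If `k = n`, all ranks agree, and the
slope of `D` is smaller because an inclusion which is not an isomorphism vanishes in some fiber
(`Hom.isIso_of_forall_ne_zero`), and then lowers the degree (`Hom.IsSheafMono.degree_lt`).
Conversely, stability applied to the standard subchains gives `α ∈ H`, and if `φ i = 0`, then `C` is
the direct sum of two proper subchains, whose slopes cannot both be smaller than their weighted mean.

The analytic core is the comparison of degrees, with degrees given by integrals of Chern forms. Let
`f : F → L` be injective on sections, let `g` and `h` be metrics, and let `u = |f|²` with respect to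
them: a smooth function on `X`, locally `|c|² e^{P - Q}` with `c` holomorphic and `P`, `Q` the
logarithms of the Gram functions of `h` and `g`. Off the zeros of `c`,
`Δ log (u + ε) = u / (u + ε) (ΔP - ΔQ) + ε u / (u + ε)² |∇ log u|²`
(`laplacian_log_sqNorm_add`). The integral over `X` of the left side vanishes by Stokes' theorem
(`formIntegral_laplacian_eq_zero`, from a partition of unity and the conformal covariance of the
Laplacian). As `ε → 0` the first term on the right tends to `ΔP - ΔQ`, whose integral is
`-4π (deg L - deg F)`, and the second is nonnegative; so `deg F ≤ deg L`. Near a zero of `f` of order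
`m`, the second term with `ε = r ^ (2 m)` is at least a constant times `r⁻²` on an annulus of area
proportional to `r²` (`exists_gradient_term_lower_bound`), so its integral does not tend to zero, and
the inequality is strict.
-/

noncomputable section

namespace HolomorphicChain

universe u

open Filter Topology

/-! ### The Laplacian in the plane -/

/-- The Laplacian on `ℂ` as the trace of the second derivative. -/
theorem laplacian_eq_fderiv_fderiv (f : ℂ → ℝ) (z : ℂ) :
    Laplacian.laplacian f z = fderiv ℝ (fderiv ℝ f) z 1 1
      + fderiv ℝ (fderiv ℝ f) z Complex.I Complex.I := by
  rw [InnerProductSpace.laplacian_eq_iteratedFDeriv_complexPlane]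
  simp [iteratedFDeriv_two_apply]

theorem fderiv_fderiv_apply {f : ℂ → ℝ} {z : ℂ} (hf : ContDiffAt ℝ 2 f z) (v w : ℂ) :
    fderiv ℝ (fderiv ℝ f) z v w = fderiv ℝ (fun y => fderiv ℝ f y w) z v := by
  have hd : DifferentiableAt ℝ (fderiv ℝ f) z :=
    (hf.fderiv_right (m := 1) (by norm_num)).differentiableAt (by norm_num)
  rw [fderiv_clm_apply hd (differentiableAt_const w)]
  simp

/-- Conformal covariance of the Laplacian: `Δ (u ∘ τ) = |τ'|² (Δ u) ∘ τ` for holomorphic `τ`. -/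
theorem laplacian_comp_holomorphic {u : ℂ → ℝ} {τ : ℂ → ℂ} {z : ℂ} (hτ : AnalyticAt ℂ τ z)
    (hu : ContDiffAt ℝ 2 u (τ z)) :
    Laplacian.laplacian (fun w => u (τ w)) z = ‖deriv τ z‖ ^ 2 * Laplacian.laplacian u (τ z) := by
  have hτR : ContDiffAt ℝ 2 τ z := (hτ.contDiffAt (n := 2)).restrict_scalars ℝ
  have hcomp : ContDiffAt ℝ 2 (fun w => u (τ w)) z := hu.comp z hτR
  have hdu : DifferentiableAt ℝ (fderiv ℝ u) (τ z) :=
    (hu.fderiv_right (m := 1) (by norm_num)).differentiableAt (by norm_num)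
  have key : ∀ v : ℂ, fderiv ℝ (fderiv ℝ (fun w => u (τ w))) z v v =
      fderiv ℝ (fderiv ℝ u) (τ z) (deriv τ z * v) (deriv τ z * v)
        + fderiv ℝ u (τ z) (deriv (deriv τ) z * v * v) := by
    intro v
    rw [fderiv_fderiv_apply hcomp]
    have hev : (fun y => fderiv ℝ (fun w => u (τ w)) y v) =ᶠ[𝓝 z]
        fun y => fderiv ℝ u (τ y) (deriv τ y * v) := by
      have h1 : ∀ᶠ y in 𝓝 z, DifferentiableAt ℝ u (τ y) :=
        hτ.continuousAt.eventually
          ((hu.eventually (by simp)).mono fun y hy => hy.differentiableAt (by norm_num))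
      filter_upwards [h1, hτ.eventually_analyticAt] with y hy1 hy2
      have h2 : HasFDerivAt τ
          ((ContinuousLinearMap.toSpanSingleton ℂ (deriv τ y)).restrictScalars ℝ) y :=
        hy2.differentiableAt.hasDerivAt.hasFDerivAt.restrictScalars ℝ
      have h3 := (hy1.hasFDerivAt.comp y h2).fderiv
      have h4 : (fun w => u (τ w)) = u ∘ τ := rfl
      rw [h4, h3]
      simp [mul_comm]
    rw [hev.fderiv_eq]
    have hd2 : HasFDerivAt (deriv τ)
        ((ContinuousLinearMap.toSpanSingleton ℂ (deriv (deriv τ) z)).restrictScalars ℝ) z :=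
      hτ.deriv.differentiableAt.hasDerivAt.hasFDerivAt.restrictScalars ℝ
    have hd1 : HasFDerivAt τ
        ((ContinuousLinearMap.toSpanSingleton ℂ (deriv τ z)).restrictScalars ℝ) z :=
      hτ.differentiableAt.hasDerivAt.hasFDerivAt.restrictScalars ℝ
    have hA := hdu.hasFDerivAt.comp z hd1
    have hB := hd2.mul_const' v
    have := (hA.clm_apply hB).fderiv
    simp only [Function.comp_apply] at this
    rw [this]
    simp [mul_comm]
    ring
  rw [laplacian_eq_fderiv_fderiv, laplacian_eq_fderiv_fderiv, key, key]
  set t := deriv τ z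
  set B := fderiv ℝ (fderiv ℝ u) (τ z)
  have e1 : t * 1 = t.re • (1 : ℂ) + t.im • Complex.I := by
    apply Complex.ext <;> simp
  have e2 : t * Complex.I = (-t.im) • (1 : ℂ) + t.re • Complex.I := by
    apply Complex.ext <;> simp
  have e3 : deriv (deriv τ) z * Complex.I * Complex.I = -(deriv (deriv τ) z * 1 * 1) := by
    rw [mul_assoc, Complex.I_mul_I]; ring
  rw [e3, e1, e2, map_neg]
  have e4 : ‖t‖ ^ 2 = t.re ^ 2 + t.im ^ 2 := by
    rw [Complex.sq_norm, Complex.normSq_apply]; ring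
  rw [e4]
  simp only [map_add, map_smul, add_apply, smul_apply,
    smul_eq_mul]
  ring

/-- Chain rule for the Laplacian of a function of a real function. -/
theorem laplacian_comp_real {a : ℂ → ℝ} {z : ℂ} {l l₁ : ℝ → ℝ} {l₂ : ℝ}
    (ha : ContDiffAt ℝ 2 a z) (hl : ContDiffAt ℝ 2 l (a z)) (h₁ : ∀ t, HasDerivAt l (l₁ t) t)
    (h₂ : HasDerivAt l₁ l₂ (a z)) :
    Laplacian.laplacian (fun w => l (a w)) z = l₁ (a z) * Laplacian.laplacian a z
      + l₂ * (fderiv ℝ a z 1 ^ 2 + fderiv ℝ a z Complex.I ^ 2) := by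
  have hcomp : ContDiffAt ℝ 2 (fun w => l (a w)) z := hl.comp z ha
  have key : ∀ v : ℂ, fderiv ℝ (fderiv ℝ (fun w => l (a w))) z v v =
      l₁ (a z) * fderiv ℝ (fderiv ℝ a) z v v + l₂ * fderiv ℝ a z v ^ 2 := by
    intro v
    rw [fderiv_fderiv_apply hcomp, fderiv_fderiv_apply ha]
    have hev : (fun y => fderiv ℝ (fun w => l (a w)) y v) =ᶠ[𝓝 z]
        fun y => l₁ (a y) * fderiv ℝ a y v := by
      filter_upwards [ha.eventually (by simp)] with y hy
      have h3 := ((h₁ (a y)).comp_hasFDerivAt y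
        (hy.differentiableAt (by norm_num)).hasFDerivAt).fderiv
      have h4 : (fun w => l (a w)) = l ∘ a := rfl
      rw [h4, h3]
      simp
    rw [hev.fderiv_eq]
    have hA := h₂.comp_hasFDerivAt z (ha.differentiableAt (by norm_num)).hasFDerivAt
    have hB : DifferentiableAt ℝ (fun y => fderiv ℝ a y v) z :=
      ((ha.fderiv_right (m := 1) (by norm_num)).differentiableAt (by norm_num)).clm_apply
        (differentiableAt_const v)
    have := (hA.mul hB.hasFDerivAt).fderiv
    simp only [Function.comp_def] at this
    erw [this]
    simp
    ring
  rw [laplacian_eq_fderiv_fderiv, laplacian_eq_fderiv_fderiv, key, key]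
  ring

/-- The integral over `ℂ` of the Laplacian of a compactly supported function vanishes. -/
theorem integral_laplacian_eq_zero {w : ℂ → ℝ} (hw : ContDiff ℝ 2 w) (hs : HasCompactSupport w) :
    ∫ z, Laplacian.laplacian w z = 0 := by
  have key : ∀ v : ℂ, Integrable (fun z => fderiv ℝ (fun y => fderiv ℝ w y v) z v) ∧
      ∫ z, fderiv ℝ (fun y => fderiv ℝ w y v) z v = 0 := by
    intro v
    have hg : ContDiff ℝ 1 (fun y => fderiv ℝ w y v) :=
      (hw.fderiv_right (m := 1) (by norm_num)).clm_apply contDiff_const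
    have hgs : HasCompactSupport (fun y => fderiv ℝ w y v) := hs.fderiv_apply ℝ v
    have hi : Integrable (fun z => fderiv ℝ (fun y => fderiv ℝ w y v) z v) :=
      ((hg.continuous_fderiv (by norm_num)).clm_apply continuous_const).integrable_of_hasCompactSupport
        (hgs.fderiv_apply ℝ v)
    refine ⟨hi, ?_⟩
    have := integral_mul_fderiv_eq_neg_fderiv_mul_of_integrable (μ := volume) (𝕜 := ℝ)
      (f := fun _ : ℂ => (1 : ℝ)) (g := fun y => fderiv ℝ w y v) (v := v)
      (by simp) (by simpa using hi)
      (by simpa using hg.continuous.integrable_of_hasCompactSupport hgs)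
      (fun x _ => differentiableAt_const _)
      (fun x _ => hg.differentiable (by norm_num) x)
    simpa using this
  have h : ∀ z, Laplacian.laplacian w z = fderiv ℝ (fun y => fderiv ℝ w y 1) z 1
      + fderiv ℝ (fun y => fderiv ℝ w y Complex.I) z Complex.I := by
    intro z
    rw [laplacian_eq_fderiv_fderiv, fderiv_fderiv_apply hw.contDiffAt,
      fderiv_fderiv_apply hw.contDiffAt]
  simp_rw [h]
  rw [integral_add (key 1).1 (key Complex.I).1, (key 1).2, (key Complex.I).2, add_zero]

/-- The Laplacian of `log |c|² + P - Q`, for `c` holomorphic and nonzero at `z`. -/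
theorem laplacian_log_norm_sq_add_sub {c : ℂ → ℂ} {P Q : ℂ → ℝ} {z : ℂ} (hc : AnalyticAt ℂ c z)
    (h0 : c z ≠ 0) (hP : ContDiffAt ℝ 2 P z) (hQ : ContDiffAt ℝ 2 Q z) :
    ContDiffAt ℝ 2 (fun w => 2 * Real.log ‖c w‖ + P w - Q w) z ∧
    Laplacian.laplacian (fun w => 2 * Real.log ‖c w‖ + P w - Q w) z =
      Laplacian.laplacian P z - Laplacian.laplacian Q z := by
  have hh := hc.harmonicAt_log_norm h0
  have h1 : ContDiffAt ℝ 2 (fun w => Real.log ‖c w‖) z := hh.1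
  have h2 : ContDiffAt ℝ 2 ((2 : ℝ) • fun w => Real.log ‖c w‖) z := contDiffAt_const.smul h1
  have e : (fun w => 2 * Real.log ‖c w‖ + P w - Q w)
      = (((2 : ℝ) • fun w => Real.log ‖c w‖) + P) - Q := by
    ext w; simp
  refine ⟨?_, ?_⟩
  · rw [e]; exact (h2.add hP).sub hQ
  · have h3 : ContDiffAt ℝ 2 (((2 : ℝ) • fun w => Real.log ‖c w‖) + P) z := h2.add hP
    rw [e, h3.laplacian_sub hQ, h2.laplacian_add hP,
      InnerProductSpace.laplacian_smul _ h1]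
    have := hh.2.self_of_nhds
    simp only [Pi.zero_apply] at this
    rw [this]; simp

/-- The function `|c|² e^{P - Q}`: the squared norm of a homomorphism of line bundles with
matrix `c` with respect to the metrics with Gram functions `e^Q` and `e^P`. -/
def sqNorm (c : ℂ → ℂ) (P Q : ℂ → ℝ) (z : ℂ) : ℝ := ‖c z‖ ^ 2 * Real.exp (P z - Q z)

theorem sqNorm_nonneg (c : ℂ → ℂ) (P Q : ℂ → ℝ) (z : ℂ) : 0 ≤ sqNorm c P Q z := by
  unfold sqNorm; positivity

theorem sqNorm_pos {c : ℂ → ℂ} (P Q : ℂ → ℝ) {z : ℂ} (h : c z ≠ 0) : 0 < sqNorm c P Q z := by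
  have := norm_pos_iff.2 h
  unfold sqNorm; positivity

theorem exp_eq_sqNorm {c : ℂ → ℂ} (P Q : ℂ → ℝ) {z : ℂ} (h : c z ≠ 0) :
    Real.exp (2 * Real.log ‖c z‖ + P z - Q z) = sqNorm c P Q z := by
  have := norm_pos_iff.2 h
  rw [add_sub_assoc, Real.exp_add, sqNorm, two_mul, Real.exp_add, Real.exp_log this, sq]

/-- The squared length of the gradient of `log (|c|² e^{P - Q})`. -/
def gradSq (c : ℂ → ℂ) (P Q : ℂ → ℝ) (z : ℂ) : ℝ :=
  fderiv ℝ (fun w => 2 * Real.log ‖c w‖ + P w - Q w) z 1 ^ 2 +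
    fderiv ℝ (fun w => 2 * Real.log ‖c w‖ + P w - Q w) z Complex.I ^ 2

/-- The Laplacian of `log (u + ε)` off the zeros of `u = |c|² e^{P - Q}`, by the chain rule applied to
`log (e ^ t + ε)` at `t = log u`, where `Δ log u = ΔP - ΔQ`. -/
theorem laplacian_log_sqNorm_add {c : ℂ → ℂ} {P Q : ℂ → ℝ} {z : ℂ} {ε : ℝ} (hε : 0 < ε)
    (hc : AnalyticAt ℂ c z)
    (h0 : c z ≠ 0) (hP : ContDiffAt ℝ 2 P z) (hQ : ContDiffAt ℝ 2 Q z) :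
    Laplacian.laplacian (fun w => Real.log (sqNorm c P Q w + ε)) z =
      sqNorm c P Q z / (sqNorm c P Q z + ε) *
          (Laplacian.laplacian P z - Laplacian.laplacian Q z) +
        ε * sqNorm c P Q z / (sqNorm c P Q z + ε) ^ 2 * gradSq c P Q z := by
  obtain ⟨ha, hlap⟩ := laplacian_log_norm_sq_add_sub hc h0 hP hQ
  have hev : (fun w => Real.log (sqNorm c P Q w + ε)) =ᶠ[𝓝 z]
      fun w => Real.log (Real.exp (2 * Real.log ‖c w‖ + P w - Q w) + ε) := by
    filter_upwards [hc.continuousAt.eventually_ne h0] with w hw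
    rw [exp_eq_sqNorm P Q hw]
  rw [(InnerProductSpace.laplacian_congr_nhds hev).self_of_nhds]
  have hpos : ∀ t : ℝ, Real.exp t + ε ≠ 0 := fun t => by positivity
  have h1 : ∀ t : ℝ, HasDerivAt (fun t => Real.log (Real.exp t + ε))
      (Real.exp t / (Real.exp t + ε)) t := fun t =>
    ((Real.hasDerivAt_exp t).add_const ε).log (hpos t)
  have h2 : ∀ t : ℝ, HasDerivAt (fun t => Real.exp t / (Real.exp t + ε))
      (ε * Real.exp t / (Real.exp t + ε) ^ 2) t := fun t => by
    have := (Real.hasDerivAt_exp t).div ((Real.hasDerivAt_exp t).add_const ε) (hpos t)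
    refine this.congr_deriv ?_
    ring
  have hl : ∀ t : ℝ, ContDiffAt ℝ 2 (fun t => Real.log (Real.exp t + ε)) t := fun t =>
    (Real.contDiff_exp.contDiffAt.add contDiffAt_const).log (hpos t)
  rw [laplacian_comp_real (l := fun t => Real.log (Real.exp t + ε)) ha (hl _) h1 (h2 _), hlap,
    exp_eq_sqNorm P Q h0, gradSq]

/-- Near a zero `p` of order `m` of `c`, the gradient term in the Laplacian of
`log (|c|² e^{P - Q} + ε)` for `ε = r ^ (2 m)` is at least of order `r⁻²` on the annulus
`r / 2 ≤ |z - p| ≤ r`. -/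
theorem exists_gradient_term_lower_bound {c : ℂ → ℂ} {P Q : ℂ → ℝ} {p : ℂ}
    (hc : AnalyticAt ℂ c p) (h0 : c p = 0) (hne : ¬ ∀ᶠ z in 𝓝 p, c z = 0)
    (hP : ContDiffAt ℝ 2 P p) (hQ : ContDiffAt ℝ 2 Q p) :
    ∃ δ > 0, ∃ m : ℕ, m ≠ 0 ∧ ∀ᶠ r : ℝ in 𝓝[>] 0, ∀ z : ℂ, r / 2 ≤ ‖z - p‖ → ‖z - p‖ ≤ r →
      δ / r ^ 2 ≤ r ^ (2 * m) * sqNorm c P Q z / (sqNorm c P Q z + r ^ (2 * m)) ^ 2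
        * gradSq c P Q z := by
  obtain ⟨m, g, hg, hg0, hcg⟩ := hc.exists_eventuallyEq_pow_smul_nonzero_iff.2 hne
  have hm : m ≠ 0 := by
    rintro rfl
    have := hcg.self_of_nhds
    simp [h0] at this
    exact hg0 this.symm
  obtain ⟨hb, -⟩ := laplacian_log_norm_sq_add_sub hg hg0 hP hQ
  set b : ℂ → ℝ := fun w => 2 * Real.log ‖g w‖ + P w - Q w with hbdef
  set A : ℝ := Real.exp (b p)
  have hA : 0 < A := Real.exp_pos _
  set K : ℝ := ‖fderiv ℝ b p‖ + 1
  have hK : 0 < K := by positivity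
  have hbd : ∀ᶠ z in 𝓝 p, ‖fderiv ℝ b z‖ < K :=
    ((hb.fderiv_right (m := 1) (by norm_num)).continuousAt.norm).eventually_lt
      continuousAt_const (by simp [K])
  have hcont : ContinuousAt (fun z => Real.exp (b z)) p := hb.continuousAt.rexp
  have hlo : ∀ᶠ z in 𝓝 p, A / 2 < Real.exp (b z) :=
    continuousAt_const.eventually_lt hcont (by simp only [A]; linarith)
  have hhi : ∀ᶠ z in 𝓝 p, Real.exp (b z) < 2 * A :=
    hcont.eventually_lt continuousAt_const (by simp only [A]; linarith)
  have hball : ∀ᶠ z in 𝓝 p, ‖z - p‖ < 1 / K := by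
    have : ContinuousAt (fun z : ℂ => ‖z - p‖) p := by fun_prop
    exact this.eventually_lt continuousAt_const (by simpa using by positivity)
  have hall := hcg.eventually_nhds.and (hbd.and (hlo.and (hhi.and (hball.and
    ((hb.eventually (by simp)).and (hg.continuousAt.eventually_ne hg0).eventually_nhds)))))
  obtain ⟨R, hR, hRall⟩ := Metric.eventually_nhds_iff.1 hall
  refine ⟨(1 / 4) ^ m * (A / 2) / (2 * A + 1) ^ 2, by positivity, m, hm, ?_⟩
  filter_upwards [Ioo_mem_nhdsGT hR] with r hr z hz1 hz2
  obtain ⟨hr0, hrR⟩ := hr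
  obtain ⟨hz, hzK, hzlo, hzhi, hz1K, hzb, hzg⟩ := hRall (y := z)
    (by rw [dist_eq_norm]; linarith)
  have hv : 0 < ‖z - p‖ := by linarith
  have hvne : z - p ≠ 0 := norm_pos_iff.1 hv
  have hzg0 : g z ≠ 0 := hzg.self_of_nhds
  -- `u = |z - p| ^ (2 m) e^b` with `b` smooth at `p`
  have hu : sqNorm c P Q z = (‖z - p‖ ^ 2) ^ m * Real.exp (b z) := by
    rw [exp_eq_sqNorm P Q hzg0, sqNorm, sqNorm, hz.self_of_nhds, norm_smul, norm_pow]
    ring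
  have hev : (fun w => 2 * Real.log ‖c w‖ + P w - Q w) =ᶠ[𝓝 z]
      fun w => m * Real.log (‖w - p‖ ^ 2) + b w := by
    have h1 : ∀ᶠ w in 𝓝 z, w - p ≠ 0 :=
      (by fun_prop : ContinuousAt (fun w : ℂ => w - p) z).eventually_ne hvne
    filter_upwards [hz, h1, hzg] with w hw hw1 hw2
    rw [hw, norm_smul, norm_pow, Real.log_mul (by positivity) (by positivity), Real.log_pow,
      Real.log_pow]
    simp only [hbdef]
    push_cast; ring
  -- in the radial direction `z - p` the derivative of `m log |w - p|²` is `2 m ≥ 2`, and that of `b`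
  -- is at most `1` in absolute value
  have hgrad : 1 ≤ fderiv ℝ (fun w => 2 * Real.log ‖c w‖ + P w - Q w) z (z - p) := by
    rw [hev.fderiv_eq]
    have hn : HasFDerivAt (fun w : ℂ => w - p) (ContinuousLinearMap.id ℝ ℂ) z :=
      (hasFDerivAt_id z).sub_const p
    have hl := ((hn.norm_sq).log (by positivity)).const_mul (m : ℝ)
    have := (hl.add (hzb.differentiableAt (by norm_num)).hasFDerivAt).fderiv
    have e : (fun w => (m : ℝ) * Real.log (‖w - p‖ ^ 2) + b w) =
      ((fun w => (m : ℝ) * Real.log (‖w - p‖ ^ 2)) + b) := rfl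
    rw [e, this]
    simp only [add_apply, smul_apply, ContinuousLinearMap.comp_apply,
      ContinuousLinearMap.id_apply, innerSL_apply_apply, real_inner_self_eq_norm_sq, smul_eq_mul]
    have h3 : |fderiv ℝ b z (z - p)| ≤ 1 := by
      have := (fderiv ℝ b z).le_opNorm (z - p)
      rw [Real.norm_eq_abs] at this
      calc _ ≤ _ := this
        _ ≤ K * (1 / K) := by gcongr
        _ = 1 := by field_simp
    have h4 : (1 : ℝ) ≤ m := by exact_mod_cast Nat.one_le_iff_ne_zero.2 hm
    have h5 : (‖z - p‖ ^ 2)⁻¹ * (2 • ‖z - p‖ ^ 2) = 2 := by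
      rw [nsmul_eq_mul]; field_simp; norm_num
    rw [h5]
    have := (abs_le.1 h3).1
    linarith
  have hgs : 1 / r ^ 2 ≤ gradSq c P Q z := by
    unfold gradSq
    set L := fderiv ℝ (fun w => 2 * Real.log ‖c w‖ + P w - Q w) z
    have e1 : z - p = (z - p).re • (1 : ℂ) + (z - p).im • Complex.I := by
      apply Complex.ext <;> simp
    rw [e1, map_add, map_smul, map_smul, smul_eq_mul, smul_eq_mul] at hgrad
    have e2 : (z - p).re ^ 2 + (z - p).im ^ 2 ≤ r ^ 2 := by
      have : ‖z - p‖ ^ 2 = (z - p).re ^ 2 + (z - p).im ^ 2 := by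
        rw [Complex.sq_norm, Complex.normSq_apply]; ring
      rw [← this]; gcongr
    rw [div_le_iff₀ (by positivity)]
    set x := (z - p).re
    set y := (z - p).im
    have e3 : (x * L 1 + y * L Complex.I) ^ 2 ≤ (L 1 ^ 2 + L Complex.I ^ 2) * (x ^ 2 + y ^ 2) := by
      nlinarith [sq_nonneg (x * L Complex.I - y * L 1)]
    have e4 : (L 1 ^ 2 + L Complex.I ^ 2) * (x ^ 2 + y ^ 2) ≤
        (L 1 ^ 2 + L Complex.I ^ 2) * r ^ 2 := by gcongr
    nlinarith
  set ε := r ^ (2 * m) with hε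
  have hε0 : 0 < ε := by positivity
  have hεr : ε = (r ^ 2) ^ m := by rw [hε, pow_mul]
  have hulo : ε * ((1 / 4) ^ m * (A / 2)) ≤ sqNorm c P Q z := by
    rw [hu, hεr, ← mul_assoc, ← mul_pow]
    gcongr
    nlinarith
  have huhi : sqNorm c P Q z ≤ ε * (2 * A) := by
    rw [hu, hεr]
    gcongr
  have hfac : (1 / 4) ^ m * (A / 2) / (2 * A + 1) ^ 2 ≤
      ε * sqNorm c P Q z / (sqNorm c P Q z + ε) ^ 2 := by
    have hu0 := sqNorm_nonneg c P Q z
    calc _ = ε * (ε * ((1 / 4) ^ m * (A / 2))) / (ε * (2 * A) + ε) ^ 2 := by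
          field_simp
      _ ≤ _ := by gcongr
  calc _ = (1 / 4) ^ m * (A / 2) / (2 * A + 1) ^ 2 * (1 / r ^ 2) := by ring
    _ ≤ _ := mul_le_mul hfac hgs (by positivity)
      (div_nonneg (mul_nonneg hε0.le (sqNorm_nonneg c P Q z)) (sq_nonneg _))

/-! ### Integration of `2`-forms on a compact Riemann surface -/

theorem abs_det_mul_complex (t : ℂ) :
    |((ContinuousLinearMap.toSpanSingleton ℂ t).restrictScalars ℝ).det| = ‖t‖ ^ 2 := by
  have h : LinearMap.toMatrix Complex.basisOneI Complex.basisOneI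
      (((ContinuousLinearMap.toSpanSingleton ℂ t).restrictScalars ℝ : ℂ →L[ℝ] ℂ) : ℂ →ₗ[ℝ] ℂ)
      = !![t.re, -t.im; t.im, t.re] := by
    ext i j
    fin_cases i <;> fin_cases j <;> simp [LinearMap.toMatrix_apply]
  rw [ContinuousLinearMap.det, ← LinearMap.det_toMatrix Complex.basisOneI, h, Matrix.det_fin_two_of,
    Complex.sq_norm, Complex.normSq_apply, abs_of_nonneg] <;> nlinarith [sq_nonneg t.re, sq_nonneg t.im]

theorem continuousAt_laplacian {f : ℂ → ℝ} {z : ℂ} (hf : ContDiffAt ℝ 2 f z) :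
    ContinuousAt (Laplacian.laplacian f) z := by
  have h1 : ContDiffAt ℝ 1 (fderiv ℝ f) z := hf.fderiv_right (m := 1) (by norm_num)
  have h2 : ContinuousAt (fderiv ℝ (fderiv ℝ f)) z :=
    (h1.fderiv_right (m := 0) (by norm_num)).continuousAt
  have h : Laplacian.laplacian f = fun z => fderiv ℝ (fderiv ℝ f) z 1 1
      + fderiv ℝ (fderiv ℝ f) z Complex.I Complex.I := by
    ext z; exact laplacian_eq_fderiv_fderiv f z
  rw [h]
  exact ((h2.clm_apply continuousAt_const).clm_apply continuousAt_const).add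
    ((h2.clm_apply continuousAt_const).clm_apply continuousAt_const)

section Surface

variable {X : Type u} [TopologicalSpace X] [ChartedSpace ℂ X]

/-- A Riemann surface is a smooth real manifold. -/
theorem isManifold_real [IsManifold 𝓘(ℂ, ℂ) ω X] : IsManifold 𝓘(ℝ, ℂ) ∞ X := by
  apply isManifold_of_contDiffOn
  intro e e' he he'
  have h := (contDiffGroupoid ω 𝓘(ℂ, ℂ)).compatible he he'
  rw [contDiffGroupoid, mem_groupoid_of_pregroupoid, contDiffPregroupoid] at h
  have h1 := (ContDiffOn.restrict_scalars ℝ h.1).of_le (m := ∞) le_top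
  simpa using! h1

/-- The transition map from the chart at `x₀` to the chart at `x₁`. -/
def transition (x₀ x₁ : X) (z : ℂ) : ℂ := chartAt ℂ x₁ ((chartAt ℂ x₀).symm z)

/-- The domain of the transition map. -/
def overlap (x₀ x₁ : X) : Set ℂ :=
  (chartAt ℂ x₀).target ∩ (chartAt ℂ x₀).symm ⁻¹' (chartAt ℂ x₁).source

theorem isOpen_overlap (x₀ x₁ : X) : IsOpen (overlap x₀ x₁) :=
  (chartAt ℂ x₀).isOpen_inter_preimage_symm (chartAt ℂ x₁).open_source

theorem transition_symm {x₀ x₁ : X} {z : ℂ} (hz : z ∈ overlap x₀ x₁) :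
    (chartAt ℂ x₁).symm (transition x₀ x₁ z) = (chartAt ℂ x₀).symm z :=
  (chartAt ℂ x₁).left_inv hz.2

theorem transition_mem {x₀ x₁ : X} {z : ℂ} (hz : z ∈ overlap x₀ x₁) :
    transition x₀ x₁ z ∈ overlap x₁ x₀ :=
  ⟨(chartAt ℂ x₁).map_source hz.2, by
    rw [mem_preimage, transition_symm hz]; exact (chartAt ℂ x₀).map_target hz.1⟩

theorem transition_transition {x₀ x₁ : X} {z : ℂ} (hz : z ∈ overlap x₀ x₁) :
    transition x₁ x₀ (transition x₀ x₁ z) = z := by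
  rw [transition, transition_symm hz, (chartAt ℂ x₀).right_inv hz.1]

theorem transition_image (x₀ x₁ : X) : transition x₀ x₁ '' overlap x₀ x₁ = overlap x₁ x₀ := by
  ext w
  constructor
  · rintro ⟨z, hz, rfl⟩; exact transition_mem hz
  · exact fun hw => ⟨_, transition_mem hw, transition_transition hw⟩

theorem analyticAt_transition [IsManifold 𝓘(ℂ, ℂ) ω X] {x₀ x₁ : X} {z : ℂ}
    (hz : z ∈ overlap x₀ x₁) : AnalyticAt ℂ (transition x₀ x₁) z := by
  have h1 : ContMDiffAt 𝓘(ℂ, ℂ) 𝓘(ℂ, ℂ) ω (chartAt ℂ x₀).symm z :=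
    (contMDiffOn_chart_symm (x := x₀)).contMDiffAt ((chartAt ℂ x₀).open_target.mem_nhds hz.1)
  have h2 : ContMDiffAt 𝓘(ℂ, ℂ) 𝓘(ℂ, ℂ) ω (chartAt ℂ x₁) ((chartAt ℂ x₀).symm z) :=
    (contMDiffOn_chart (x := x₁)).contMDiffAt ((chartAt ℂ x₁).open_source.mem_nhds hz.2)
  exact (contMDiffAt_iff_contDiffAt.1 (h2.comp z h1)).analyticAt

/-- Change of charts: two functions which represent the same `2`-form in two charts, and vanish
off the intersection of the charts, have the same integral. -/
theorem setIntegral_change_chart [IsManifold 𝓘(ℂ, ℂ) ω X] (x₀ x₁ : X) {f₀ f₁ : ℂ → ℝ}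
    (h : ∀ z ∈ overlap x₀ x₁, f₀ z = ‖deriv (transition x₀ x₁) z‖ ^ 2 * f₁ (transition x₀ x₁ z))
    (h₀ : ∀ z ∈ (chartAt ℂ x₀).target, z ∉ overlap x₀ x₁ → f₀ z = 0)
    (h₁ : ∀ z ∈ (chartAt ℂ x₁).target, z ∉ overlap x₁ x₀ → f₁ z = 0) :
    ∫ z in (chartAt ℂ x₀).target, f₀ z = ∫ z in (chartAt ℂ x₁).target, f₁ z := by
  have e0 : ∫ z in (chartAt ℂ x₀).target, f₀ z = ∫ z in overlap x₀ x₁, f₀ z :=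
    setIntegral_eq_of_subset_of_forall_sdiff_eq_zero
      (chartAt ℂ x₀).open_target.measurableSet inter_subset_left fun z hz => h₀ z hz.1 hz.2
  have e1 : ∫ z in (chartAt ℂ x₁).target, f₁ z = ∫ z in overlap x₁ x₀, f₁ z :=
    setIntegral_eq_of_subset_of_forall_sdiff_eq_zero
      (chartAt ℂ x₁).open_target.measurableSet inter_subset_left fun z hz => h₁ z hz.1 hz.2
  rw [e0, e1, ← transition_image x₀ x₁]
  rw [integral_image_eq_integral_abs_det_fderiv_smul volume (isOpen_overlap x₀ x₁).measurableSet
    (f' := fun z => (ContinuousLinearMap.toSpanSingleton ℂ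
      (deriv (transition x₀ x₁) z)).restrictScalars ℝ)]
  · refine setIntegral_congr_fun (isOpen_overlap x₀ x₁).measurableSet fun z hz => ?_
    simp only [abs_det_mul_complex, smul_eq_mul]
    exact h z hz
  · intro z hz
    exact ((analyticAt_transition hz).differentiableAt.hasDerivAt.hasFDerivAt.restrictScalars
      ℝ).hasFDerivWithinAt
  · intro z hz w hw hzw
    rw [← transition_transition hz, ← transition_transition hw, hzw]

/-- The image in the chart at `x₀` of a subset of `X`. -/
def chartImage (x₀ : X) (S : Set X) : Set ℂ :=
  (chartAt ℂ x₀).target ∩ (chartAt ℂ x₀).symm ⁻¹' S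

theorem isOpen_chartImage (x₀ : X) {S : Set X} (hS : IsOpen S) : IsOpen (chartImage x₀ S) :=
  (chartAt ℂ x₀).isOpen_inter_preimage_symm hS

theorem integrableOn_of_eq_zero [CompactSpace X] {x₀ : X} {K : Set X} {F : ℂ → ℝ}
    (hK : IsClosed K) (hKs : K ⊆ (chartAt ℂ x₀).source)
    (hF : ContinuousOn F (chartImage x₀ K))
    (h0 : ∀ z ∈ (chartAt ℂ x₀).target, (chartAt ℂ x₀).symm z ∉ K → F z = 0) :
    IntegrableOn F (chartAt ℂ x₀).target := by
  set e := chartAt ℂ x₀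
  have hc : IsCompact (e '' K) :=
    hK.isCompact.image_of_continuousOn (e.continuousOn.mono hKs)
  have hsub : e '' K ⊆ chartImage x₀ K := by
    rintro _ ⟨x, hx, rfl⟩
    exact ⟨e.map_source (hKs hx), by rw [mem_preimage, e.left_inv (hKs hx)]; exact hx⟩
  have h1 : IntegrableOn F (e '' K) := (hF.mono hsub).integrableOn_compact hc
  exact h1.of_forall_sdiff_eq_zero e.open_target.measurableSet fun z hz =>
    h0 z hz.1 fun h => hz.2 ⟨_, h, e.right_inv hz.1⟩

theorem integrableOn_mul_of_tsupport [CompactSpace X] {x₀ : X} {S : Set X} {η : X → ℝ} {κ : ℂ → ℝ}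
    (hS : S ⊆ (chartAt ℂ x₀).source) (hη : Continuous η) (hηS : tsupport η ⊆ S)
    (hκ : ContinuousOn κ (chartImage x₀ S)) :
    IntegrableOn (fun z => η ((chartAt ℂ x₀).symm z) * κ z) (chartAt ℂ x₀).target := by
  refine integrableOn_of_eq_zero (isClosed_tsupport η) (hηS.trans hS) ?_ fun z _ hz => ?_
  · exact (hη.comp_continuousOn ((chartAt ℂ x₀).continuousOn_symm.mono inter_subset_left)).mul
      (hκ.mono fun z hz => ⟨hz.1, hηS hz.2⟩)
  · rw [image_eq_zero_of_notMem_tsupport hz, zero_mul]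

/-- The integral over `X`, by means of a partition of unity `σ`, of the `2`-form given by the
density `κ x₀` in the chart around `x₀`. -/
def formIntegral (σ : SmoothPartitionOfUnity X 𝓘(ℝ, ℂ) X univ) (κ : X → ℂ → ℝ) : ℝ :=
  ∑ᶠ x₀ : X, ∫ z in (chartAt ℂ x₀).target, σ x₀ ((chartAt ℂ x₀).symm z) * κ x₀ z

/-- On a compact space only finitely many members of a partition of unity are nonzero. -/
theorem exists_finset_partition [CompactSpace X]
    (σ : SmoothPartitionOfUnity X 𝓘(ℝ, ℂ) X univ) :
    ∃ I : Finset X, (∀ i ∉ I, ∀ x, σ i x = 0) ∧ ∀ x, ∑ i ∈ I, σ i x = 1 := by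
  have hfin := σ.locallyFinite.finite_nonempty_of_compact
  have h0 : ∀ i ∉ hfin.toFinset, ∀ x, σ i x = 0 := by
    intro i hi x
    by_contra hx
    exact hi (hfin.mem_toFinset.2 ⟨x, hx⟩)
  refine ⟨hfin.toFinset, h0, fun x => ?_⟩
  rw [← σ.sum_eq_one (mem_univ x)]
  refine (finsum_eq_sum_of_support_subset _ fun i hi => ?_).symm
  by_contra hI
  exact hi (h0 i hI x)

theorem formIntegral_eq_sum {σ : SmoothPartitionOfUnity X 𝓘(ℝ, ℂ) X univ} {I : Finset X}
    (hI : ∀ i ∉ I, ∀ x, σ i x = 0) (κ : X → ℂ → ℝ) :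
    formIntegral σ κ =
      ∑ i ∈ I, ∫ z in (chartAt ℂ i).target, σ i ((chartAt ℂ i).symm z) * κ i z := by
  refine finsum_eq_sum_of_support_subset _ fun i hi => ?_
  by_contra h
  exact hi (by simp [hI i h])

/-- The densities `κ`, defined in the charts over the sets `S i`, and `κ'`, defined over the sets
`S' j`, represent the same `2`-form where both are defined. -/
def Compatible (S S' : X → Set X) (κ κ' : X → ℂ → ℝ) : Prop :=
  ∀ i j, ∀ z ∈ (chartAt ℂ i).target, (chartAt ℂ i).symm z ∈ S i → (chartAt ℂ i).symm z ∈ S' j →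
    κ i z = ‖deriv (transition i j) z‖ ^ 2 * κ' j (transition i j z)

/-- The integral of a `2`-form does not depend on the partition of unity. -/
theorem formIntegral_congr [T2Space X] [CompactSpace X] [IsManifold 𝓘(ℂ, ℂ) ω X]
    {σ σ' : SmoothPartitionOfUnity X 𝓘(ℝ, ℂ) X univ} {S S' : X → Set X} {κ κ' : X → ℂ → ℝ}
    (hS : ∀ i, S i ⊆ (chartAt ℂ i).source) (hS' : ∀ i, S' i ⊆ (chartAt ℂ i).source)
    (hσ : σ.IsSubordinate S) (hσ' : σ'.IsSubordinate S')
    (hκ : ∀ i, ContinuousOn (κ i) (chartImage i (S i)))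
    (hκ' : ∀ i, ContinuousOn (κ' i) (chartImage i (S' i)))
    (hc : Compatible S S' κ κ') : formIntegral σ κ = formIntegral σ' κ' := by
  obtain ⟨I, hI, hI1⟩ := exists_finset_partition σ
  obtain ⟨J, hJ, hJ1⟩ := exists_finset_partition σ'
  rw [formIntegral_eq_sum hI, formIntegral_eq_sum hJ]
  have hcont : ∀ i, Continuous (σ i) := fun i => (σ i).contMDiff.continuous
  have hcont' : ∀ i, Continuous (σ' i) := fun i => (σ' i).contMDiff.continuous
  have e1 : ∀ i, ∫ z in (chartAt ℂ i).target, σ i ((chartAt ℂ i).symm z) * κ i z =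
      ∑ j ∈ J, ∫ z in (chartAt ℂ i).target,
        (σ i ((chartAt ℂ i).symm z) * σ' j ((chartAt ℂ i).symm z)) * κ i z := by
    intro i
    rw [← integral_finsetSum]
    · refine setIntegral_congr_fun (chartAt ℂ i).open_target.measurableSet fun z _ => ?_
      rw [← Finset.sum_mul, ← Finset.mul_sum, hJ1, mul_one]
    · intro j _
      exact integrableOn_mul_of_tsupport (η := fun x => σ i x * σ' j x) (hS i)
        ((hcont i).mul (hcont' j)) ((tsupport_mul_subset_left).trans (hσ i)) (hκ i)
  have e2 : ∀ j, ∫ z in (chartAt ℂ j).target, σ' j ((chartAt ℂ j).symm z) * κ' j z =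
      ∑ i ∈ I, ∫ z in (chartAt ℂ j).target,
        (σ i ((chartAt ℂ j).symm z) * σ' j ((chartAt ℂ j).symm z)) * κ' j z := by
    intro j
    rw [← integral_finsetSum]
    · refine setIntegral_congr_fun (chartAt ℂ j).open_target.measurableSet fun z _ => ?_
      rw [← Finset.sum_mul, ← Finset.sum_mul, hI1, one_mul]
    · intro i _
      exact integrableOn_mul_of_tsupport (η := fun x => σ i x * σ' j x) (hS' j)
        ((hcont i).mul (hcont' j)) ((tsupport_mul_subset_right).trans (hσ' j)) (hκ' j)
  simp_rw [e1, e2]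
  rw [Finset.sum_comm]
  refine Finset.sum_congr rfl fun j _ => Finset.sum_congr rfl fun i _ => ?_
  have hmem : ∀ x, σ i x * σ' j x ≠ 0 → x ∈ S i ∧ x ∈ S' j := fun x hx =>
    ⟨hσ i (subset_tsupport _ (left_ne_zero_of_mul hx)),
      hσ' j (subset_tsupport _ (right_ne_zero_of_mul hx))⟩
  apply setIntegral_change_chart
  · intro z hz
    rw [transition_symm hz]
    by_cases h0 : σ i ((chartAt ℂ i).symm z) * σ' j ((chartAt ℂ i).symm z) = 0
    · simp [h0]
    · rw [hc i j z hz.1 (hmem _ h0).1 (hmem _ h0).2]; ring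
  · intro z hz hzn
    by_contra h0
    exact hzn ⟨hz, hS' j (hmem _ (left_ne_zero_of_mul h0)).2⟩
  · intro z hz hzn
    by_contra h0
    exact hzn ⟨hz, hS i (hmem _ (left_ne_zero_of_mul h0)).1⟩

theorem contDiffAt_comp_chart_symm [IsManifold 𝓘(ℂ, ℂ) ω X] {v : X → ℝ} {x₀ : X} {z : ℂ}
    (hz : z ∈ (chartAt ℂ x₀).target)
    (hv : ContMDiffAt 𝓘(ℝ, ℂ) 𝓘(ℝ, ℝ) ∞ v ((chartAt ℂ x₀).symm z)) :
    ContDiffAt ℝ ∞ (fun z => v ((chartAt ℂ x₀).symm z)) z := by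
  have : IsManifold 𝓘(ℝ, ℂ) ∞ X := isManifold_real
  have h1 : ContMDiffAt 𝓘(ℝ, ℂ) 𝓘(ℝ, ℂ) ∞ (chartAt ℂ x₀).symm z :=
    (contMDiffOn_chart_symm (x := x₀)).contMDiffAt ((chartAt ℂ x₀).open_target.mem_nhds hz)
  exact contMDiffAt_iff_contDiffAt.1 (hv.comp z h1)

/-- The Laplacians of the local expressions of a function transform like a `2`-form. -/
theorem laplacian_chart_change [IsManifold 𝓘(ℂ, ℂ) ω X] {v : X → ℝ} {x₀ x₁ : X} {z : ℂ}
    (hz : z ∈ overlap x₀ x₁)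
    (hv : ContMDiffAt 𝓘(ℝ, ℂ) 𝓘(ℝ, ℝ) ∞ v ((chartAt ℂ x₀).symm z)) :
    Laplacian.laplacian (fun z => v ((chartAt ℂ x₀).symm z)) z =
      ‖deriv (transition x₀ x₁) z‖ ^ 2 *
        Laplacian.laplacian (fun z => v ((chartAt ℂ x₁).symm z)) (transition x₀ x₁ z) := by
  have hv' : ContDiffAt ℝ 2 (fun z => v ((chartAt ℂ x₁).symm z)) (transition x₀ x₁ z) :=
    (contDiffAt_comp_chart_symm (transition_mem hz).1
      (by rwa [transition_symm hz])).of_le ENat.LEInfty.out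
  rw [← laplacian_comp_holomorphic (analyticAt_transition hz) hv']
  refine (InnerProductSpace.laplacian_congr_nhds ?_).self_of_nhds
  filter_upwards [(isOpen_overlap x₀ x₁).mem_nhds hz] with w hw
  rw [transition_symm hw]

theorem integral_laplacian_chart_eq_zero [CompactSpace X] [T2Space X] [IsManifold 𝓘(ℂ, ℂ) ω X]
    {w : X → ℝ} (hw : ContMDiff 𝓘(ℝ, ℂ) 𝓘(ℝ, ℝ) ∞ w) {j : X}
    (hs : tsupport w ⊆ (chartAt ℂ j).source) :
    ∫ z in (chartAt ℂ j).target, Laplacian.laplacian (fun z => w ((chartAt ℂ j).symm z)) z = 0 := by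
  classical
  set e := chartAt ℂ j
  have hK : IsCompact (e '' tsupport w) :=
    (isClosed_tsupport w).isCompact.image_of_continuousOn (e.continuousOn.mono hs)
  set f : ℂ → ℝ := fun z => if z ∈ e.target then w (e.symm z) else 0 with hf
  have h0 : ∀ z ∉ e '' tsupport w, f z = 0 := by
    intro z hz
    simp only [hf]
    split_ifs with h
    · exact image_eq_zero_of_notMem_tsupport fun h' => hz ⟨_, h', e.right_inv h⟩
    · rfl
  have hev : ∀ z ∈ e.target, f =ᶠ[𝓝 z] fun z => w (e.symm z) := by
    intro z hz
    filter_upwards [e.open_target.mem_nhds hz] with y hy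
    simp [hf, hy]
  have hev0 : ∀ z ∉ e '' tsupport w, f =ᶠ[𝓝 z] fun _ => 0 := by
    intro z hz
    filter_upwards [hK.isClosed.isOpen_compl.mem_nhds hz] with y hy
    exact h0 y hy
  have hfs : HasCompactSupport f := HasCompactSupport.intro hK h0
  have hfd : ContDiff ℝ 2 f := by
    rw [contDiff_iff_contDiffAt]
    intro z
    by_cases hz : z ∈ e.target
    · exact ((contDiffAt_comp_chart_symm hz hw.contMDiffAt).of_le
        ENat.LEInfty.out).congr_of_eventuallyEq (hev z hz)
    · have : z ∉ e '' tsupport w := by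
        rintro ⟨x, hx, rfl⟩; exact hz (e.map_source (hs hx))
      exact contDiffAt_const.congr_of_eventuallyEq (hev0 z this)
  have hmain := integral_laplacian_eq_zero hfd hfs
  rw [← hmain, ← setIntegral_eq_integral_of_forall_compl_eq_zero (s := e.target)
    (f := Laplacian.laplacian f)]
  · refine setIntegral_congr_fun e.open_target.measurableSet fun z hz => ?_
    exact (InnerProductSpace.laplacian_congr_nhds (hev z hz)).self_of_nhds.symm
  · intro z hz
    have : z ∉ e '' tsupport w := by
      rintro ⟨x, hx, rfl⟩; exact hz (e.map_source (hs hx))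
    rw [(InnerProductSpace.laplacian_congr_nhds (hev0 z this)).self_of_nhds]
    simp

theorem continuousOn_laplacian_chart [IsManifold 𝓘(ℂ, ℂ) ω X] {v : X → ℝ} {x₀ : X} {S : Set X}
    (hS : IsOpen S) (hv : ContMDiffOn 𝓘(ℝ, ℂ) 𝓘(ℝ, ℝ) ∞ v S) :
    ContinuousOn (Laplacian.laplacian (fun z => v ((chartAt ℂ x₀).symm z))) (chartImage x₀ S) := by
  intro z hz
  exact (continuousAt_laplacian
    ((contDiffAt_comp_chart_symm hz.1 (hv.contMDiffAt (hS.mem_nhds hz.2))).of_le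
      ENat.LEInfty.out)).continuousWithinAt

/-- Stokes' theorem for `∂∂̄ v`: the integral over a compact Riemann surface of the Laplacian of a
smooth function vanishes. -/
theorem formIntegral_laplacian_eq_zero [CompactSpace X] [T2Space X] [IsManifold 𝓘(ℂ, ℂ) ω X]
    {σ : SmoothPartitionOfUnity X 𝓘(ℝ, ℂ) X univ}
    (hσ : σ.IsSubordinate fun i => (chartAt ℂ i).source)
    {v : X → ℝ} (hv : ContMDiff 𝓘(ℝ, ℂ) 𝓘(ℝ, ℝ) ∞ v) :
    formIntegral σ (fun i => Laplacian.laplacian fun z => v ((chartAt ℂ i).symm z)) = 0 := by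
  obtain ⟨I, hI, hI1⟩ := exists_finset_partition σ
  rw [formIntegral_eq_sum hI]
  have hcont : ∀ i, Continuous (σ i) := fun i => (σ i).contMDiff.continuous
  set w : X → X → ℝ := fun j x => σ j x * v x with hwdef
  have hw : ∀ j, ContMDiff 𝓘(ℝ, ℂ) 𝓘(ℝ, ℝ) ∞ (w j) := fun j => (σ j).contMDiff.mul hv
  have hws : ∀ j, tsupport (w j) ⊆ (chartAt ℂ j).source := fun j =>
    tsupport_mul_subset_left.trans (hσ j)
  have hint : ∀ i j, IntegrableOn (fun z => σ i ((chartAt ℂ i).symm z) *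
      Laplacian.laplacian (fun z => w j ((chartAt ℂ i).symm z)) z) (chartAt ℂ i).target :=
    fun i j => integrableOn_mul_of_tsupport (S := (chartAt ℂ i).source) subset_rfl (hcont i) (hσ i)
      (continuousOn_laplacian_chart (chartAt ℂ i).open_source (hw j).contMDiffOn)
  have e1 : ∀ i, ∫ z in (chartAt ℂ i).target, σ i ((chartAt ℂ i).symm z) *
      Laplacian.laplacian (fun z => v ((chartAt ℂ i).symm z)) z =
      ∑ j ∈ I, ∫ z in (chartAt ℂ i).target, σ i ((chartAt ℂ i).symm z) *
        Laplacian.laplacian (fun z => w j ((chartAt ℂ i).symm z)) z := by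
    intro i
    rw [← integral_finsetSum _ fun j _ => hint i j]
    refine setIntegral_congr_fun (chartAt ℂ i).open_target.measurableSet fun z hz => ?_
    have hsum : (fun z => v ((chartAt ℂ i).symm z)) =
        fun z => ∑ j ∈ I, w j ((chartAt ℂ i).symm z) := by
      ext z
      simp only [hwdef]
      rw [← Finset.sum_mul, hI1, one_mul]
    have hlap : ∀ J : Finset X, Laplacian.laplacian
        (fun z => ∑ j ∈ J, w j ((chartAt ℂ i).symm z)) z =
        ∑ j ∈ J, Laplacian.laplacian (fun z => w j ((chartAt ℂ i).symm z)) z := by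
      have hd : ∀ j, ContDiffAt ℝ 2 (fun z => w j ((chartAt ℂ i).symm z)) z := fun j =>
        (contDiffAt_comp_chart_symm hz (hw j).contMDiffAt).of_le ENat.LEInfty.out
      classical
      intro J
      induction J using Finset.induction_on with
      | empty => simp
      | insert a J ha ih =>
        simp_rw [Finset.sum_insert ha]
        rw [← ih]
        exact (hd a).laplacian_add (ContDiffAt.sum fun j _ => hd j)
    rw [hsum, hlap, Finset.mul_sum]
  simp_rw [e1]
  rw [Finset.sum_comm]
  refine Finset.sum_eq_zero fun j _ => ?_
  rw [← integral_laplacian_chart_eq_zero (hw j) (hws j)]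
  have hzero : ∀ i, ∀ z ∈ (chartAt ℂ i).target, (chartAt ℂ i).symm z ∉ tsupport (w j) →
      Laplacian.laplacian (fun z => w j ((chartAt ℂ i).symm z)) z = 0 := by
    intro i z hz hn
    have : (fun z => w j ((chartAt ℂ i).symm z)) =ᶠ[𝓝 z] fun _ => 0 := by
      filter_upwards [((chartAt ℂ i).continuousAt_symm hz).preimage_mem_nhds
        ((isClosed_tsupport _).isOpen_compl.mem_nhds hn)] with y hy
      exact image_eq_zero_of_notMem_tsupport hy
    rw [(InnerProductSpace.laplacian_congr_nhds this).self_of_nhds]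
    simp
  have e2 : ∀ i, ∫ z in (chartAt ℂ i).target, σ i ((chartAt ℂ i).symm z) *
        Laplacian.laplacian (fun z => w j ((chartAt ℂ i).symm z)) z =
      ∫ z in (chartAt ℂ j).target, σ i ((chartAt ℂ j).symm z) *
        Laplacian.laplacian (fun z => w j ((chartAt ℂ j).symm z)) z := by
    intro i
    apply setIntegral_change_chart
    · intro z hz
      rw [transition_symm hz, laplacian_chart_change hz (hw j).contMDiffAt]; ring
    · intro z hz hzn
      rw [hzero i z hz fun h => hzn ⟨hz, hws j h⟩, mul_zero]
    · intro z hz hzn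
      by_contra h0
      exact hzn ⟨hz, hσ i (subset_tsupport _ (left_ne_zero_of_mul h0))⟩
  simp_rw [e2]
  rw [← integral_finsetSum]
  · refine setIntegral_congr_fun (chartAt ℂ j).open_target.measurableSet fun z _ => ?_
    rw [← Finset.sum_mul, hI1, one_mul]
  · intro i _
    refine integrableOn_of_eq_zero (isClosed_tsupport (w j)) (hws j) ?_ fun z hz hzn => ?_
    · exact ((hcont i).comp_continuousOn
        ((chartAt ℂ j).continuousOn_symm.mono inter_subset_left)).mul
        ((continuousOn_laplacian_chart (chartAt ℂ j).open_source (hw j).contMDiffOn).mono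
          fun z hz => ⟨hz.1, hws j hz.2⟩)
    · rw [hzero j z hz hzn, mul_zero]

theorem exists_partition_subordinate [CompactSpace X] [T2Space X] [IsManifold 𝓘(ℂ, ℂ) ω X]
    {S : X → Set X} (hS : ∀ x, IsOpen (S x)) (hx : ∀ x, x ∈ S x) :
    ∃ σ : SmoothPartitionOfUnity X 𝓘(ℝ, ℂ) X univ, σ.IsSubordinate S := by
  have : IsManifold 𝓘(ℝ, ℂ) ∞ X := isManifold_real
  exact SmoothPartitionOfUnity.exists_isSubordinate _ isClosed_univ S hS
    fun x _ => mem_iUnion_of_mem x (hx x)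

end Surface

/-! ### Frames, metrics and degrees of holomorphic vector bundles -/

section Bundles

variable {X : Type u} [TopologicalSpace X] [ChartedSpace ℂ X]

/-- The domain of the preferred local trivialization around `x₀`. -/
def HolBundle.base (E : HolBundle X) (x₀ : X) : Set X :=
  (trivializationAt E.Model E.fiber x₀).baseSet

/-- The coordinates of a vector of `E` with respect to the holomorphic frame around `x₀`; zero at the
points `x` outside the domain of the frame. -/
def HolBundle.coord (E : HolBundle X) (x₀ x : X) : E.fiber x →ₗ[ℂ] E.Model :=
  (trivializationAt E.Model E.fiber x₀).linearMapAt ℂ x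

theorem HolBundle.isOpen_base (E : HolBundle X) (x₀ : X) : IsOpen (E.base x₀) :=
  (trivializationAt E.Model E.fiber x₀).open_baseSet

theorem HolBundle.mem_base (E : HolBundle X) (x₀ : X) : x₀ ∈ E.base x₀ :=
  mem_baseSet_trivializationAt E.Model E.fiber x₀

theorem HolBundle.isOpen_patch (E : HolBundle X) (x₀ : X) : IsOpen (E.patch x₀) :=
  (chartAt ℂ x₀).open_source.inter (E.isOpen_base x₀)

theorem HolBundle.mem_patch (E : HolBundle X) (x₀ : X) : x₀ ∈ E.patch x₀ :=
  ⟨mem_chart_source ℂ x₀, E.mem_base x₀⟩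

theorem HolBundle.coord_apply (E : HolBundle X) {x₀ x : X} (hx : x ∈ E.base x₀) (v : E.fiber x) :
    E.coord x₀ x v = (trivializationAt E.Model E.fiber x₀ ⟨x, v⟩).2 := by
  rw [HolBundle.coord, Trivialization.coe_linearMapAt_of_mem _ hx]

theorem HolBundle.coord_frame (E : HolBundle X) {x₀ x : X} (hx : x ∈ E.base x₀)
    (j : Fin E.rank) : E.coord x₀ x (E.frame x₀ j x) = Pi.single j 1 := by
  rw [E.coord_apply hx, HolBundle.frame, Trivialization.apply_mk_symm _ hx]

theorem HolBundle.coord_injective (E : HolBundle X) {x₀ x : X} (hx : x ∈ E.base x₀) :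
    Function.Injective (E.coord x₀ x) := by
  intro v w h
  rw [E.coord_apply hx, E.coord_apply hx] at h
  rw [← (trivializationAt E.Model E.fiber x₀).symm_apply_apply_mk hx v, h,
    (trivializationAt E.Model E.fiber x₀).symm_apply_apply_mk hx w]

theorem HolBundle.sum_coord_smul_frame (E : HolBundle X) {x₀ x : X} (hx : x ∈ E.base x₀)
    (v : E.fiber x) : ∑ j, E.coord x₀ x v j • E.frame x₀ j x = v := by
  apply E.coord_injective hx
  rw [map_sum]
  simp_rw [map_smul, E.coord_frame hx]
  ext k
  simp [Finset.sum_apply, Pi.single_apply]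

theorem HolBundle.frame_ne_zero (E : HolBundle X) {x₀ x : X} (hx : x ∈ E.base x₀)
    (j : Fin E.rank) : E.frame x₀ j x ≠ 0 := by
  intro h
  have := congrFun (E.coord_frame hx j) j
  rw [h] at this
  simp at this

/-- Frames are holomorphic. -/
theorem HolBundle.isHolSection_frame (E : HolBundle X) (x₀ : X) (j : Fin E.rank) :
    E.IsHolSection (E.base x₀) (E.frame x₀ j) := by
  unfold HolBundle.IsHolSection
  rw [(trivializationAt E.Model E.fiber x₀).contMDiffOn_iff]
  · refine ⟨contMDiffOn_id, (contMDiffOn_const (c := Pi.single j (1 : ℂ))).congr fun x hx => ?_⟩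
    rw [← E.coord_apply hx, E.coord_frame hx]
  · intro x hx
    exact (Trivialization.mem_source _).2 hx

theorem HolBundle.contMDiffOn_coord (E : HolBundle X) {x₀ : X} {U : Set X} (hU : U ⊆ E.base x₀)
    {s : ∀ x, E.fiber x} (hs : E.IsHolSection U s) (k : Fin E.rank) :
    ContMDiffOn 𝓘(ℂ, ℂ) 𝓘(ℂ, ℂ) ω (fun x => E.coord x₀ x (s x) k) U := by
  unfold HolBundle.IsHolSection at hs
  rw [(trivializationAt E.Model E.fiber x₀).contMDiffOn_iff
    (fun x hx => (Trivialization.mem_source _).2 (hU hx))] at hs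
  have h1 : ContMDiff 𝓘(ℂ, E.Model) 𝓘(ℂ, ℂ) ω (fun v : E.Model => v k) :=
    (ContinuousLinearMap.proj (R := ℂ) (φ := fun _ : Fin E.rank => ℂ) k).contDiff.contMDiff
  exact (h1.comp_contMDiffOn hs.2).congr fun x hx => by
    rw [E.coord_apply (hU hx)]; rfl

theorem Hom.isHolSection_map {E F : HolBundle X} (f : Hom E F) {U : Set X}
    {s : ∀ x, E.fiber x} (hs : E.IsHolSection U s) :
    F.IsHolSection U (fun x => f.toFun x (s x)) :=
  f.holomorphic.comp_contMDiffOn hs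

/-- The `(k, j)` entry of the matrix of a homomorphism with respect to the frames around `x₀`
and `x₁`. -/
def Hom.coef {E F : HolBundle X} (f : Hom E F) (x₀ x₁ : X) (j : Fin E.rank) (k : Fin F.rank)
    (x : X) : ℂ :=
  F.coord x₁ x (f.toFun x (E.frame x₀ j x)) k

theorem Hom.contMDiffOn_coef {E F : HolBundle X} (f : Hom E F) (x₀ x₁ : X) (j : Fin E.rank)
    (k : Fin F.rank) :
    ContMDiffOn 𝓘(ℂ, ℂ) 𝓘(ℂ, ℂ) ω (f.coef x₀ x₁ j k) (E.base x₀ ∩ F.base x₁) :=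
  F.contMDiffOn_coord inter_subset_right
    ((f.isHolSection_map (E.isHolSection_frame x₀ j)).mono inter_subset_left) k

theorem Hom.map_frame {E F : HolBundle X} (f : Hom E F) {x₀ x₁ x : X} (hx₁ : x ∈ F.base x₁)
    (j : Fin E.rank) :
    f.toFun x (E.frame x₀ j x) = ∑ k, f.coef x₀ x₁ j k x • F.frame x₁ k x :=
  (F.sum_coord_smul_frame hx₁ _).symm

/-- The identity homomorphism. -/
def Hom.id (E : HolBundle X) : Hom E E where
  toFun _ := LinearMap.id
  holomorphic := contMDiff_id

/-- A holomorphic function is smooth in the real sense. -/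
theorem contMDiffAt_real {f : X → ℂ} {x : X} (hf : ContMDiffAt 𝓘(ℂ, ℂ) 𝓘(ℂ, ℂ) ω f x) :
    ContMDiffAt 𝓘(ℝ, ℂ) 𝓘(ℝ, ℂ) ∞ f x := by
  rw [contMDiffAt_iff] at hf ⊢
  exact ⟨hf.1, (hf.2.restrict_scalars ℝ).of_le le_top⟩

theorem Hom.analyticAt_coef [IsManifold 𝓘(ℂ, ℂ) ω X] {E F : HolBundle X} (f : Hom E F)
    {x₀ x₁ y : X} (j : Fin E.rank) (k : Fin F.rank) {z : ℂ}
    (hz : z ∈ chartImage y (E.base x₀ ∩ F.base x₁)) :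
    AnalyticAt ℂ (fun z => f.coef x₀ x₁ j k ((chartAt ℂ y).symm z)) z := by
  have h1 : ContMDiffAt 𝓘(ℂ, ℂ) 𝓘(ℂ, ℂ) ω (chartAt ℂ y).symm z :=
    (contMDiffOn_chart_symm (x := y)).contMDiffAt ((chartAt ℂ y).open_target.mem_nhds hz.1)
  have h2 := (f.contMDiffOn_coef x₀ x₁ j k).contMDiffAt
    (((E.isOpen_base x₀).inter (F.isOpen_base x₁)).mem_nhds hz.2)
  exact (contMDiffAt_iff_contDiffAt.1 (h2.comp z h1)).analyticAt

/-- Every holomorphic vector bundle over a compact Riemann surface has a Hermitian metric. -/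
theorem exists_hermitianMetric [T2Space X] [CompactSpace X] [IsManifold 𝓘(ℂ, ℂ) ω X]
    (E : HolBundle X) : Nonempty (HermitianMetric E) := by
  obtain ⟨σ, hσ⟩ := exists_partition_subordinate E.isOpen_base E.mem_base
  obtain ⟨I, hI, hI1⟩ := exists_finset_partition σ
  refine ⟨{
    form := fun x => LinearMap.mk₂'ₛₗ (starRingEnd ℂ) (RingHom.id ℂ)
      (fun v w => ∑ i ∈ I, ∑ k, (σ i x : ℂ) * (starRingEnd ℂ (E.coord i x v k) * E.coord i x w k))
      ?_ ?_ ?_ ?_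
    conj_symm := ?_
    pos := ?_
    smooth := ?_ }⟩
  · intro v v' w
    simp only [map_add, Pi.add_apply, add_mul, mul_add, Finset.sum_add_distrib]
  · intro c v w
    simp only [map_smul, Pi.smul_apply, smul_eq_mul, map_mul, Finset.mul_sum]
    refine Finset.sum_congr rfl fun i _ => Finset.sum_congr rfl fun k _ => by ring
  · intro v w w'
    simp only [map_add, Pi.add_apply, mul_add, Finset.sum_add_distrib]
  · intro c v w
    simp only [map_smul, Pi.smul_apply, smul_eq_mul, Finset.mul_sum, RingHom.id_apply]
    refine Finset.sum_congr rfl fun i _ => Finset.sum_congr rfl fun k _ => by ring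
  · intro x v w
    simp only [LinearMap.mk₂'ₛₗ_apply, map_sum, map_mul, Complex.conj_ofReal, Complex.conj_conj]
    refine Finset.sum_congr rfl fun i _ => Finset.sum_congr rfl fun k _ => by ring
  · intro x v hv
    have hterm : ∀ i k, ((σ i x : ℂ) * (starRingEnd ℂ (E.coord i x v k) * E.coord i x v k)).re =
        σ i x * Complex.normSq (E.coord i x v k) := by
      intro i k
      rw [mul_comm (starRingEnd ℂ _), Complex.mul_conj, ← Complex.ofReal_mul, Complex.ofReal_re]
    have hnn : ∀ i k, 0 ≤ σ i x * Complex.normSq (E.coord i x v k) := fun i k =>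
      mul_nonneg (σ.nonneg i x) (Complex.normSq_nonneg _)
    simp only [LinearMap.mk₂'ₛₗ_apply, Complex.re_sum, hterm]
    obtain ⟨i, hi⟩ := σ.exists_pos_of_mem (mem_univ x)
    have hiI : i ∈ I := by
      by_contra h
      exact hi.ne' (hI i h x)
    have hxi : x ∈ E.base i := hσ i (subset_tsupport _ hi.ne')
    have hvi : E.coord i x v ≠ 0 := fun h =>
      hv (E.coord_injective hxi (by rw [h, map_zero]))
    obtain ⟨k, hk⟩ := Function.ne_iff.1 hvi
    refine Finset.sum_pos' (fun i _ => Finset.sum_nonneg fun k _ => hnn i k) ⟨i, hiI, ?_⟩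
    exact Finset.sum_pos' (fun k _ => hnn i k)
      ⟨k, Finset.mem_univ k, mul_pos hi (Complex.normSq_pos.2 hk)⟩
  · intro x₀ j k x hx
    apply ContMDiffAt.contMDiffWithinAt
    simp only [LinearMap.mk₂'ₛₗ_apply]
    refine ContMDiffAt.sum fun i _ => ContMDiffAt.sum fun l _ => ?_
    by_cases hxi : x ∈ tsupport (σ i)
    · have hc : ∀ j, ContMDiffAt 𝓘(ℝ, ℂ) 𝓘(ℝ, ℂ) ∞
          (fun x => E.coord i x (E.frame x₀ j x) l) x := fun j =>
        contMDiffAt_real (((Hom.id E).contMDiffOn_coef x₀ i j l).contMDiffAt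
          (((E.isOpen_base x₀).inter (E.isOpen_base i)).mem_nhds ⟨hx, hσ i hxi⟩))
      have h1 : ContMDiffAt 𝓘(ℝ, ℂ) 𝓘(ℝ, ℂ) ∞ (fun x => ((σ i x : ℝ) : ℂ)) x :=
        (Complex.ofRealCLM.contDiff.contMDiff.contMDiffAt).comp x (σ i).contMDiff.contMDiffAt
      have h2 : ContMDiffAt 𝓘(ℝ, ℂ) 𝓘(ℝ, ℂ) ∞
          (fun x => starRingEnd ℂ (E.coord i x (E.frame x₀ j x) l)) x :=
        (Complex.conjCLE.contDiff.contMDiff.contMDiffAt).comp x (hc j)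
      have hmul : ContMDiff 𝓘(ℝ, ℂ × ℂ) 𝓘(ℝ, ℂ) ∞ (fun p : ℂ × ℂ => p.1 * p.2) :=
        contDiff_mul.contMDiff
      exact hmul.contMDiffAt.comp x
        (h1.prodMk_space (hmul.contMDiffAt.comp x (h2.prodMk_space (hc k))))
    · refine (contMDiffAt_const (c := (0 : ℂ))).congr_of_eventuallyEq ?_
      filter_upwards [(isClosed_tsupport _).isOpen_compl.mem_nhds hxi] with y hy
      rw [image_eq_zero_of_notMem_tsupport hy]
      simp

theorem HolBundle.exists_degree_eq [T2Space X] [CompactSpace X] [IsManifold 𝓘(ℂ, ℂ) ω X]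
    (E : HolBundle X) : ∃ (h : HermitianMetric E) (ρ : SmoothPartitionOfUnity X 𝓘(ℝ, ℂ) X univ),
      ρ.IsSubordinate E.patch ∧ E.degree = h.chernNumber ρ := by
  obtain ⟨h⟩ := exists_hermitianMetric E
  obtain ⟨ρ, hρ⟩ := exists_partition_subordinate E.isOpen_patch E.mem_patch
  exact Classical.epsilon_spec (p := fun d : ℝ => ∃ (h : HermitianMetric E)
    (ρ : SmoothPartitionOfUnity X 𝓘(ℝ, ℂ) X univ), ρ.IsSubordinate E.patch ∧ d = h.chernNumber ρ)
    ⟨_, h, ρ, hρ, rfl⟩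

theorem HolBundle.degree_eq_zero [T2Space X] [CompactSpace X] [IsManifold 𝓘(ℂ, ℂ) ω X]
    (E : HolBundle X) (hE : E.rank = 0) : E.degree = 0 := by
  obtain ⟨h, ρ, -, hd⟩ := E.exists_degree_eq
  have : IsEmpty (Fin E.rank) := by rw [hE]; infer_instance
  have hg : ∀ x₀ x, h.gramDet x₀ x = 1 := fun x₀ x => by
    rw [HermitianMetric.gramDet, Matrix.det_isEmpty, Complex.one_re]
  have hc : ∀ x₀ z, h.chernDensity x₀ z = 0 := fun x₀ z => by
    simp only [HermitianMetric.chernDensity, hg, Real.log_one]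
    simp
  rw [hd, HermitianMetric.chernNumber]
  simp [hc]

section LineBundles

variable {E F : HolBundle X}

/-- The index of the only element of a frame of a line bundle. -/
def lineIndex (hE : E.rank = 1) : Fin E.rank := ⟨0, by omega⟩

theorem eq_lineIndex (hE : E.rank = 1) (j : Fin E.rank) : j = lineIndex hE := by
  ext; simp [lineIndex]; omega

theorem sum_lineIndex (hE : E.rank = 1) {M : Type*} [AddCommMonoid M] (g : Fin E.rank → M) :
    ∑ j, g j = g (lineIndex hE) := by
  have : Subsingleton (Fin E.rank) := ⟨fun a b => by rw [eq_lineIndex hE a, eq_lineIndex hE b]⟩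
  exact Fintype.sum_subsingleton _ _

theorem HermitianMetric.gramDet_eq (h : HermitianMetric E) (hE : E.rank = 1) (x₀ x : X) :
    h.gramDet x₀ x =
      (h.form x (E.frame x₀ (lineIndex hE) x) (E.frame x₀ (lineIndex hE) x)).re := by
  have : Subsingleton (Fin E.rank) := ⟨fun a b => by rw [eq_lineIndex hE a, eq_lineIndex hE b]⟩
  rw [HermitianMetric.gramDet, Matrix.det_eq_elem_of_subsingleton _ (lineIndex hE),
    Matrix.of_apply]

theorem HermitianMetric.gramDet_pos (h : HermitianMetric E) (hE : E.rank = 1) {x₀ x : X}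
    (hx : x ∈ E.base x₀) : 0 < h.gramDet x₀ x := by
  rw [h.gramDet_eq hE]
  exact h.pos x _ (E.frame_ne_zero hx _)

theorem HermitianMetric.contMDiffOn_gramDet (h : HermitianMetric E) (hE : E.rank = 1) (x₀ : X) :
    ContMDiffOn 𝓘(ℝ, ℂ) 𝓘(ℝ, ℝ) ∞ (h.gramDet x₀) (E.base x₀) := by
  have h1 := h.smooth x₀ (lineIndex hE) (lineIndex hE)
  have h2 : ContMDiff 𝓘(ℝ, ℂ) 𝓘(ℝ, ℝ) ∞ Complex.re := Complex.reCLM.contDiff.contMDiff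
  refine (h2.comp_contMDiffOn h1).congr fun x hx => ?_
  rw [h.gramDet_eq hE]; rfl

theorem HermitianMetric.form_smul_self (h : HermitianMetric E) {x : X} (c : ℂ) (v : E.fiber x) :
    (h.form x (c • v) (c • v)).re = ‖c‖ ^ 2 * (h.form x v v).re := by
  rw [map_smul, LinearMap.map_smulₛₗ₂, smul_eq_mul, smul_eq_mul, ← mul_assoc,
    Complex.mul_conj, Complex.re_ofReal_mul, Complex.sq_norm]

theorem Hom.map_frame_line (f : Hom E F) (hE : E.rank = 1) (hF : F.rank = 1) {x₀ x₁ x : X}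
    (hx₁ : x ∈ F.base x₁) :
    f.toFun x (E.frame x₀ (lineIndex hE) x) =
      f.coef x₀ x₁ (lineIndex hE) (lineIndex hF) x • F.frame x₁ (lineIndex hF) x := by
  rw [f.map_frame hx₁, sum_lineIndex hF]

/-- Gram functions in two frames differ by the squared modulus of the transition function, which is
the matrix entry of the identity. -/
theorem HermitianMetric.gramDet_change (h : HermitianMetric E) (hE : E.rank = 1) {x₀ x₁ x : X}
    (hx₁ : x ∈ E.base x₁) :
    h.gramDet x₀ x = ‖(Hom.id E).coef x₀ x₁ (lineIndex hE) (lineIndex hE) x‖ ^ 2 *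
      h.gramDet x₁ x := by
  have h1 : E.frame x₀ (lineIndex hE) x = _ := (Hom.id E).map_frame_line hE hE (x₀ := x₀) hx₁
  rw [h.gramDet_eq hE, h.gramDet_eq hE, h1, h.form_smul_self]

theorem HolBundle.transition_ne_zero (hE : E.rank = 1) {x₀ x₁ x : X} (hx₀ : x ∈ E.base x₀)
    (hx₁ : x ∈ E.base x₁) : (Hom.id E).coef x₀ x₁ (lineIndex hE) (lineIndex hE) x ≠ 0 := by
  intro h0
  have h1 : E.frame x₀ (lineIndex hE) x = _ := (Hom.id E).map_frame_line hE hE (x₀ := x₀) hx₁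
  rw [h0, zero_smul] at h1
  exact E.frame_ne_zero hx₀ _ h1

/-- The logarithm of the Gram function of a metric, in the chart around `x₀`. -/
def HermitianMetric.weight (h : HermitianMetric E) (x₀ : X) (z : ℂ) : ℝ :=
  Real.log (h.gramDet x₀ ((chartAt ℂ x₀).symm z))

theorem HermitianMetric.contDiffAt_weight [IsManifold 𝓘(ℂ, ℂ) ω X] (h : HermitianMetric E)
    (hE : E.rank = 1) {x₀ : X} {z : ℂ} (hz : z ∈ chartImage x₀ (E.base x₀)) :
    ContDiffAt ℝ 2 (h.weight x₀) z := by
  have h1 : ContDiffAt ℝ ∞ (fun z => h.gramDet x₀ ((chartAt ℂ x₀).symm z)) z :=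
    contDiffAt_comp_chart_symm hz.1
      ((h.contMDiffOn_gramDet hE x₀).contMDiffAt ((E.isOpen_base x₀).mem_nhds hz.2))
  exact (h1.log (h.gramDet_pos hE hz.2).ne').of_le ENat.LEInfty.out

theorem HermitianMetric.laplacian_weight_change [IsManifold 𝓘(ℂ, ℂ) ω X] (h : HermitianMetric E)
    (hE : E.rank = 1) {x₀ x₁ : X} {z : ℂ} (hz : z ∈ (chartAt ℂ x₀).target)
    (h₀ : (chartAt ℂ x₀).symm z ∈ E.patch x₀) (h₁ : (chartAt ℂ x₀).symm z ∈ E.patch x₁) :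
    Laplacian.laplacian (h.weight x₀) z = ‖deriv (transition x₀ x₁) z‖ ^ 2 *
      Laplacian.laplacian (h.weight x₁) (transition x₀ x₁ z) := by
  have hov : z ∈ overlap x₀ x₁ := ⟨hz, h₁.1⟩
  have hz₁ : transition x₀ x₁ z ∈ chartImage x₁ (E.base x₁) :=
    ⟨(transition_mem hov).1, by rw [mem_preimage, transition_symm hov]; exact h₁.2⟩
  have hw := h.contDiffAt_weight hE hz₁
  rw [← laplacian_comp_holomorphic (analyticAt_transition hov) hw]
  have hwc : ContDiffAt ℝ 2 (fun w => h.weight x₁ (transition x₀ x₁ w)) z :=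
    hw.comp z ((analyticAt_transition hov).contDiffAt.restrict_scalars ℝ)
  have hnear : ∀ᶠ w in 𝓝 z, w ∈ overlap x₀ x₁ ∧
      w ∈ chartImage x₀ (E.base x₀ ∩ E.base x₁) :=
    (eventually_mem_set.2 ((isOpen_overlap x₀ x₁).mem_nhds hov)).and ((isOpen_chartImage x₀
      ((E.isOpen_base x₀).inter (E.isOpen_base x₁))).mem_nhds ⟨hz, h₀.2, h₁.2⟩)
  have hlog := laplacian_log_norm_sq_add_sub (Q := fun _ => 0)
    ((Hom.id E).analyticAt_coef (lineIndex hE) (lineIndex hE) (y := x₀) (x₀ := x₀) (x₁ := x₁)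
      (z := z) ⟨hz, h₀.2, h₁.2⟩)
    (HolBundle.transition_ne_zero hE h₀.2 h₁.2) hwc contDiffAt_const
  have h2 := hlog.2
  rw [show Laplacian.laplacian (fun _ : ℂ => (0 : ℝ)) z = 0 by simp, sub_zero] at h2
  rw [← h2]
  refine (InnerProductSpace.laplacian_congr_nhds ?_).self_of_nhds
  filter_upwards [hnear] with w hw
  have hne := HolBundle.transition_ne_zero hE hw.2.2.1 hw.2.2.2
  have hpos := h.gramDet_pos hE hw.2.2.2
  rw [HermitianMetric.weight, HermitianMetric.weight, transition_symm hw.1,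
    h.gramDet_change hE hw.2.2.2, Real.log_mul (by positivity) hpos.ne', Real.log_pow]
  push_cast; ring

theorem HermitianMetric.chernNumber_eq [CompactSpace X] (h : HermitianMetric E)
    (ρ : SmoothPartitionOfUnity X 𝓘(ℝ, ℂ) X univ) :
    h.chernNumber ρ = -(1 / (4 * Real.pi)) *
      formIntegral ρ (fun i => Laplacian.laplacian (h.weight i)) := by
  obtain ⟨I, hI, -⟩ := exists_finset_partition ρ
  rw [formIntegral_eq_sum hI, Finset.mul_sum]
  have : h.chernNumber ρ = formIntegral ρ h.chernDensity := rfl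
  rw [this, formIntegral_eq_sum hI]
  refine Finset.sum_congr rfl fun i _ => ?_
  rw [← integral_const_mul]
  refine integral_congr_ae (Eventually.of_forall fun z => ?_)
  have e : h.weight i = fun w => Real.log (h.gramDet i ((chartAt ℂ i).symm w)) := rfl
  simp only [HermitianMetric.chernDensity, e]
  ring

theorem HermitianMetric.continuousOn_laplacian_weight [IsManifold 𝓘(ℂ, ℂ) ω X]
    (h : HermitianMetric E) (hE : E.rank = 1) (i : X) :
    ContinuousOn (Laplacian.laplacian (h.weight i)) (chartImage i (E.patch i)) := fun _ hz =>
  (continuousAt_laplacian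
    (h.contDiffAt_weight hE ⟨hz.1, hz.2.2⟩)).continuousWithinAt

/-- The integral of the first Chern form may be computed with any partition of unity subordinate
to sets contained in the patches of the bundle. -/
theorem HermitianMetric.formIntegral_weight_congr [T2Space X] [CompactSpace X]
    [IsManifold 𝓘(ℂ, ℂ) ω X] (h : HermitianMetric E) (hE : E.rank = 1)
    {ρ σ : SmoothPartitionOfUnity X 𝓘(ℝ, ℂ) X univ} {S : X → Set X} (hS : ∀ i, S i ⊆ E.patch i)
    (hρ : ρ.IsSubordinate E.patch) (hσ : σ.IsSubordinate S) :
    formIntegral ρ (fun i => Laplacian.laplacian (h.weight i)) =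
      formIntegral σ (fun i => Laplacian.laplacian (h.weight i)) :=
  formIntegral_congr (S := E.patch) (S' := S) (fun _ => inter_subset_left)
    (fun i => (hS i).trans inter_subset_left) hρ hσ
    (h.continuousOn_laplacian_weight hE)
    (fun i => (h.continuousOn_laplacian_weight hE i).mono fun _ hz => ⟨hz.1, hS i hz.2⟩)
    fun _ j _ hz h₀ h₁ => h.laplacian_weight_change hE hz h₀ (hS j h₁)

end LineBundles

end Bundles

/-! ### Degrees of line bundles and injective homomorphisms -/

section Comparison

variable {X : Type u} [TopologicalSpace X] [ChartedSpace ℂ X] {F L : HolBundle X}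

/-- The matrix entry of a homomorphism of line bundles, in the chart and the frames around `i`. -/
def Hom.localCoef (f : Hom F L) (hF : F.rank = 1) (hL : L.rank = 1) (i : X) (z : ℂ) : ℂ :=
  f.coef i i (lineIndex hF) (lineIndex hL) ((chartAt ℂ i).symm z)

theorem Hom.analyticAt_localCoef [IsManifold 𝓘(ℂ, ℂ) ω X] (f : Hom F L) (hF : F.rank = 1)
    (hL : L.rank = 1) {i : X} {z : ℂ} (hz : z ∈ chartImage i (F.patch i ∩ L.patch i)) :
    AnalyticAt ℂ (f.localCoef hF hL i) z :=
  f.analyticAt_coef _ _ ⟨hz.1, hz.2.1.2, hz.2.2.2⟩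

/-- An injective map of sheaves does not vanish on an open set. -/
theorem Hom.IsSheafMono.coef_not_eventually_zero {f : Hom F L} (hf : f.IsSheafMono)
    (hF : F.rank = 1) (hL : L.rank = 1) {i y : X} (hyF : y ∈ F.base i) (hyL : y ∈ L.base i) :
    ¬ ∀ᶠ x in 𝓝 y, f.coef i i (lineIndex hF) (lineIndex hL) x = 0 := by
  intro hev
  obtain ⟨U, hU, hUo, hyU⟩ := eventually_nhds_iff.1
    (hev.and (((F.isOpen_base i).inter (L.isOpen_base i)).eventually_mem ⟨hyF, hyL⟩))
  refine F.frame_ne_zero hyF (lineIndex hF) (hf U (F.frame i (lineIndex hF)) hUo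
    ((F.isHolSection_frame i _).mono fun x hx => (hU x hx).2.1) (fun x hx => ?_) y hyU)
  rw [f.map_frame_line hF hL (hU x hx).2.2, (hU x hx).1, zero_smul]

theorem Hom.IsSheafMono.localCoef_not_eventually_zero {f : Hom F L} (hf : f.IsSheafMono)
    (hF : F.rank = 1) (hL : L.rank = 1) {i : X} {z : ℂ}
    (hz : z ∈ chartImage i (F.patch i ∩ L.patch i)) :
    ¬ ∀ᶠ w in 𝓝 z, f.localCoef hF hL i w = 0 := by
  intro hev
  refine hf.coef_not_eventually_zero hF hL hz.2.1.2 hz.2.2.2 ?_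
  rw [← (chartAt ℂ i).symm.map_nhds_eq hz.1, eventually_map]
  exact hev

theorem Hom.IsSheafMono.ae_localCoef_ne_zero [IsManifold 𝓘(ℂ, ℂ) ω X] {f : Hom F L}
    (hf : f.IsSheafMono) (hF : F.rank = 1) (hL : L.rank = 1) (i : X) :
    ∀ᵐ z, z ∈ chartImage i (F.patch i ∩ L.patch i) → f.localCoef hF hL i z ≠ 0 := by
  have hV := isOpen_chartImage i ((F.isOpen_patch i).inter (L.isOpen_patch i))
  rw [← ae_restrict_iff' hV.measurableSet]
  apply ae_restrict_le_codiscreteWithin hV.measurableSet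
  change {z | f.localCoef hF hL i z ≠ 0} ∈ codiscreteWithin _
  rw [mem_codiscreteWithin_iff_forall_mem_nhdsNE]
  intro z hz
  rcases (f.analyticAt_localCoef hF hL hz).eventually_eq_zero_or_eventually_ne_zero with h | h
  · exact absurd h (hf.localCoef_not_eventually_zero hF hL hz)
  · filter_upwards [h] with w hw using Or.inl hw

/-- The squared norm of a homomorphism of line bundles at a point. -/
def Hom.sqNormAt (f : Hom F L) (hF : F.rank = 1) (g : HermitianMetric F) (h : HermitianMetric L)
    (x : X) : ℝ :=
  (h.form x (f.toFun x (F.frame x (lineIndex hF) x)) (f.toFun x (F.frame x (lineIndex hF) x))).re /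
    (g.form x (F.frame x (lineIndex hF) x) (F.frame x (lineIndex hF) x)).re

theorem Hom.sqNormAt_eq (f : Hom F L) (hF : F.rank = 1) (hL : L.rank = 1)
    (g : HermitianMetric F) (h : HermitianMetric L) {i x : X} (hxF : x ∈ F.base i)
    (hxL : x ∈ L.base i) :
    f.sqNormAt hF g h x = ‖f.coef i i (lineIndex hF) (lineIndex hL) x‖ ^ 2 *
      h.gramDet i x / g.gramDet i x := by
  have h1 : F.frame x (lineIndex hF) x = _ := (Hom.id F).map_frame_line hF hF (x₀ := x) hxF
  have ht := HolBundle.transition_ne_zero hF (F.mem_base x) hxF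
  have hg := (g.gramDet_pos hF hxF).ne'
  rw [Hom.sqNormAt, h1, map_smul, h.form_smul_self, g.form_smul_self,
    f.map_frame_line hF hL hxL, h.form_smul_self, ← h.gramDet_eq hL, ← g.gramDet_eq hF]
  have ht' := norm_ne_zero_iff.2 ht
  field_simp

theorem Hom.sqNormAt_chart (f : Hom F L) (hF : F.rank = 1) (hL : L.rank = 1)
    (g : HermitianMetric F) (h : HermitianMetric L) {i : X} {z : ℂ}
    (hz : z ∈ chartImage i (F.patch i ∩ L.patch i)) :
    f.sqNormAt hF g h ((chartAt ℂ i).symm z) =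
      sqNorm (f.localCoef hF hL i) (h.weight i) (g.weight i) z := by
  rw [f.sqNormAt_eq hF hL g h hz.2.1.2 hz.2.2.2, sqNorm, HermitianMetric.weight,
    HermitianMetric.weight, Real.exp_sub, Real.exp_log (h.gramDet_pos hL hz.2.2.2),
    Real.exp_log (g.gramDet_pos hF hz.2.1.2), Hom.localCoef, mul_div_assoc]

theorem Hom.sqNormAt_nonneg (f : Hom F L) (hF : F.rank = 1) (hL : L.rank = 1)
    (g : HermitianMetric F) (h : HermitianMetric L) (x : X) : 0 ≤ f.sqNormAt hF g h x := by
  have h1 := h.gramDet_pos hL (L.mem_base x)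
  have h2 := g.gramDet_pos hF (F.mem_base x)
  rw [f.sqNormAt_eq hF hL g h (F.mem_base x) (L.mem_base x)]
  positivity

theorem Hom.contMDiff_sqNormAt (f : Hom F L) (hF : F.rank = 1) (hL : L.rank = 1)
    (g : HermitianMetric F) (h : HermitianMetric L) :
    ContMDiff 𝓘(ℝ, ℂ) 𝓘(ℝ, ℝ) ∞ (f.sqNormAt hF g h) := by
  intro y
  have hF' := (F.isOpen_base y).mem_nhds (F.mem_base y)
  have hL' := (L.isOpen_base y).mem_nhds (L.mem_base y)
  have hc := contMDiffAt_real ((f.contMDiffOn_coef y y (lineIndex hF) (lineIndex hL)).contMDiffAt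
    (inter_mem hF' hL'))
  have hn : ContMDiff 𝓘(ℝ, ℂ) 𝓘(ℝ, ℝ) ∞ (fun w : ℂ => ‖w‖ ^ 2) := (contDiff_norm_sq ℝ).contMDiff
  have h1 := hn.contMDiffAt.comp y hc
  have h2 := (h.contMDiffOn_gramDet hL y).contMDiffAt hL'
  have h3 := (g.contMDiffOn_gramDet hF y).contMDiffAt hF'
  have h4 := (h1.mul h2).div₀ h3 (g.gramDet_pos hF (F.mem_base y)).ne'
  refine h4.congr_of_eventuallyEq ?_
  filter_upwards [hF', hL'] with x hxF hxL
  exact f.sqNormAt_eq hF hL g h hxF hxL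

theorem Hom.contMDiff_log_sqNormAt_add (f : Hom F L) (hF : F.rank = 1) (hL : L.rank = 1)
    (g : HermitianMetric F) (h : HermitianMetric L) {ε : ℝ} (hε : 0 < ε) :
    ContMDiff 𝓘(ℝ, ℂ) 𝓘(ℝ, ℝ) ∞ (fun x => Real.log (f.sqNormAt hF g h x + ε)) := by
  intro x
  have hpos : f.sqNormAt hF g h x + ε ≠ 0 := by
    have := f.sqNormAt_nonneg hF hL g h x
    positivity
  have hlog : ContMDiffAt 𝓘(ℝ, ℝ) 𝓘(ℝ, ℝ) ∞ (fun t : ℝ => Real.log (t + ε))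
      (f.sqNormAt hF g h x) :=
    ((contDiffAt_id.add contDiffAt_const).log hpos).contMDiffAt
  exact hlog.comp x (f.contMDiff_sqNormAt hF hL g h x)

/-- The gradient term `ε u / (u + ε)² |∇ log u|²` in the Laplacian of `log (u + ε)`, `u` being the
squared norm of `f`, in the chart around `i`. -/
def Hom.gradTerm (f : Hom F L) (hF : F.rank = 1) (hL : L.rank = 1) (g : HermitianMetric F)
    (h : HermitianMetric L) (ε : ℝ) (i : X) (z : ℂ) : ℝ :=
  ε * sqNorm (f.localCoef hF hL i) (h.weight i) (g.weight i) z /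
    (sqNorm (f.localCoef hF hL i) (h.weight i) (g.weight i) z + ε) ^ 2 *
    gradSq (f.localCoef hF hL i) (h.weight i) (g.weight i) z

theorem Hom.gradTerm_nonneg (f : Hom F L) (hF : F.rank = 1) (hL : L.rank = 1)
    (g : HermitianMetric F) (h : HermitianMetric L) {ε : ℝ} (hε : 0 < ε) (i : X) (z : ℂ) :
    0 ≤ f.gradTerm hF hL g h ε i z := by
  have h1 := sqNorm_nonneg (f.localCoef hF hL i) (h.weight i) (g.weight i) z
  have h2 : 0 ≤ gradSq (f.localCoef hF hL i) (h.weight i) (g.weight i) z := by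
    unfold gradSq; positivity
  unfold Hom.gradTerm
  positivity

/-- The difference of the Laplacians of the logarithms of two Gram functions in the chart around `i`:
up to the factor `-1 / 4π`, the difference of the Chern forms of `h` and `g`. -/
def curvDiff (g : HermitianMetric F) (h : HermitianMetric L) (i : X) (z : ℂ) : ℝ :=
  Laplacian.laplacian (h.weight i) z - Laplacian.laplacian (g.weight i) z

theorem continuousOn_curvDiff [IsManifold 𝓘(ℂ, ℂ) ω X] (hF : F.rank = 1) (hL : L.rank = 1) (g : HermitianMetric F)
    (h : HermitianMetric L) (i : X) :
    ContinuousOn (curvDiff g h i) (chartImage i (F.patch i ∩ L.patch i)) :=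
  ((h.continuousOn_laplacian_weight hL i).mono fun _ hz => ⟨hz.1, hz.2.2⟩).sub
    ((g.continuousOn_laplacian_weight hF i).mono fun _ hz => ⟨hz.1, hz.2.1⟩)

/-- The curvature term of the Laplacian of `log (u + ε)`, `u` being the squared norm of `f`, in the
chart around `i` and cut off by a function `η`. -/
def Hom.curvTerm (f : Hom F L) (hF : F.rank = 1) (g : HermitianMetric F) (h : HermitianMetric L)
    (η : X → ℝ) (ε : ℝ) (i : X) (z : ℂ) : ℝ :=
  η ((chartAt ℂ i).symm z) * (f.sqNormAt hF g h ((chartAt ℂ i).symm z) /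
    (f.sqNormAt hF g h ((chartAt ℂ i).symm z) + ε)) * curvDiff g h i z

theorem Hom.integrableOn_curvTerm [CompactSpace X] [IsManifold 𝓘(ℂ, ℂ) ω X] (f : Hom F L)
    (hF : F.rank = 1) (hL : L.rank = 1) (g : HermitianMetric F) (h : HermitianMetric L)
    {η : X → ℝ} {i : X} (hη : Continuous η) (hηS : tsupport η ⊆ F.patch i ∩ L.patch i) {ε : ℝ}
    (hε : 0 < ε) :
    IntegrableOn (f.curvTerm hF g h η ε i) (chartAt ℂ i).target := by
  have hu := (f.contMDiff_sqNormAt hF hL g h).continuous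
  have hratio : Continuous fun x => f.sqNormAt hF g h x / (f.sqNormAt hF g h x + ε) :=
    hu.div (hu.add continuous_const) fun x => by
      have := f.sqNormAt_nonneg hF hL g h x
      positivity
  exact integrableOn_mul_of_tsupport (S := F.patch i ∩ L.patch i)
    (η := fun x => η x * (f.sqNormAt hF g h x / (f.sqNormAt hF g h x + ε)))
    (fun x hx => hx.1.1) (hη.mul hratio) (tsupport_mul_subset_left.trans hηS)
    (continuousOn_curvDiff hF hL g h i)

theorem Hom.integrableOn_laplacian_log [CompactSpace X] [IsManifold 𝓘(ℂ, ℂ) ω X] (f : Hom F L)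
    (hF : F.rank = 1) (hL : L.rank = 1) (g : HermitianMetric F) (h : HermitianMetric L)
    {η : X → ℝ} {i : X} (hη : Continuous η) (hηS : tsupport η ⊆ (chartAt ℂ i).source) {ε : ℝ}
    (hε : 0 < ε) :
    IntegrableOn (fun z => η ((chartAt ℂ i).symm z) * Laplacian.laplacian
      (fun z => Real.log (f.sqNormAt hF g h ((chartAt ℂ i).symm z) + ε)) z)
      (chartAt ℂ i).target := by
  have hv := f.contMDiff_log_sqNormAt_add hF hL g h hε
  generalize f.sqNormAt hF g h = u at hv ⊢
  have hc := continuousOn_laplacian_chart (x₀ := i) (chartAt ℂ i).open_source hv.contMDiffOn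
  exact integrableOn_mul_of_tsupport subset_rfl hη hηS hc

theorem Hom.IsSheafMono.ae_gradTerm_eq [IsManifold 𝓘(ℂ, ℂ) ω X] {f : Hom F L}
    (hf : f.IsSheafMono) (hF : F.rank = 1) (hL : L.rank = 1) (g : HermitianMetric F)
    (h : HermitianMetric L) {η : X → ℝ} {i : X} (hηS : tsupport η ⊆ F.patch i ∩ L.patch i) {ε : ℝ}
    (hε : 0 < ε) :
    ∀ᵐ z ∂(volume.restrict (chartAt ℂ i).target),
      η ((chartAt ℂ i).symm z) * f.gradTerm hF hL g h ε i z =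
      η ((chartAt ℂ i).symm z) * Laplacian.laplacian
        (fun z => Real.log (f.sqNormAt hF g h ((chartAt ℂ i).symm z) + ε)) z -
      f.curvTerm hF g h η ε i z := by
  rw [ae_restrict_iff' (chartAt ℂ i).open_target.measurableSet]
  filter_upwards [hf.ae_localCoef_ne_zero hF hL i] with z hz hzt
  unfold Hom.curvTerm
  by_cases h0 : η ((chartAt ℂ i).symm z) = 0
  · simp [h0]
  have hzV : z ∈ chartImage i (F.patch i ∩ L.patch i) := ⟨hzt, hηS (subset_tsupport _ h0)⟩
  have hlap := laplacian_log_sqNorm_add hε (f.analyticAt_localCoef hF hL hzV) (hz hzV)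
    (h.contDiffAt_weight hL ⟨hzt, hzV.2.2.2⟩) (g.contDiffAt_weight hF ⟨hzt, hzV.2.1.2⟩)
  have hev : (fun z => Real.log (f.sqNormAt hF g h ((chartAt ℂ i).symm z) + ε)) =ᶠ[𝓝 z] fun w =>
      Real.log (sqNorm (f.localCoef hF hL i) (h.weight i) (g.weight i) w + ε) := by
    filter_upwards [(isOpen_chartImage i ((F.isOpen_patch i).inter
      (L.isOpen_patch i))).mem_nhds hzV] with w hw
    rw [f.sqNormAt_chart hF hL g h hw]
  rw [(InnerProductSpace.laplacian_congr_nhds hev).self_of_nhds, hlap,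
    f.sqNormAt_chart hF hL g h hzV, Hom.gradTerm, curvDiff]
  ring

theorem Hom.IsSheafMono.integrableOn_gradTerm [CompactSpace X] [IsManifold 𝓘(ℂ, ℂ) ω X]
    {f : Hom F L} (hf : f.IsSheafMono) (hF : F.rank = 1) (hL : L.rank = 1)
    (g : HermitianMetric F) (h : HermitianMetric L) {η : X → ℝ} {i : X} (hη : Continuous η)
    (hηS : tsupport η ⊆ F.patch i ∩ L.patch i) {ε : ℝ} (hε : 0 < ε) :
    IntegrableOn (fun z => η ((chartAt ℂ i).symm z) * f.gradTerm hF hL g h ε i z)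
      (chartAt ℂ i).target :=
  ((f.integrableOn_laplacian_log hF hL g h hη (hηS.trans fun _ hx => hx.1.1) hε).sub
    (f.integrableOn_curvTerm hF hL g h hη hηS hε)).congr
    ((hf.ae_gradTerm_eq hF hL g h hηS hε).mono fun _ hz => hz.symm)

theorem Hom.IsSheafMono.sum_gradTerm_eq [T2Space X] [CompactSpace X] [IsManifold 𝓘(ℂ, ℂ) ω X]
    {f : Hom F L} (hf : f.IsSheafMono) (hF : F.rank = 1) (hL : L.rank = 1)
    (g : HermitianMetric F) (h : HermitianMetric L)
    {σ : SmoothPartitionOfUnity X 𝓘(ℝ, ℂ) X univ}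
    (hσ : σ.IsSubordinate fun i => F.patch i ∩ L.patch i) {I : Finset X}
    (hI : ∀ i ∉ I, ∀ x, σ i x = 0) {ε : ℝ} (hε : 0 < ε) :
    ∑ i ∈ I, ∫ z in (chartAt ℂ i).target, σ i ((chartAt ℂ i).symm z) *
      f.gradTerm hF hL g h ε i z =
    -∑ i ∈ I, ∫ z in (chartAt ℂ i).target, f.curvTerm hF g h (σ i) ε i z := by
  have hσc : ∀ i, Continuous (σ i) := fun i => (σ i).contMDiff.continuous
  have hσs : ∀ i, tsupport (σ i) ⊆ (chartAt ℂ i).source := fun i x hx => (hσ i hx).1.1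
  have h1 : ∀ i, ∫ z in (chartAt ℂ i).target, σ i ((chartAt ℂ i).symm z) *
      f.gradTerm hF hL g h ε i z = _ := fun i =>
    (integral_congr_ae (hf.ae_gradTerm_eq hF hL g h (hσ i) hε)).trans
      (integral_sub (f.integrableOn_laplacian_log hF hL g h (hσc i) (hσs i) hε)
        (f.integrableOn_curvTerm hF hL g h (hσc i) (hσ i) hε))
  rw [Finset.sum_congr rfl fun i _ => h1 i, Finset.sum_sub_distrib]
  have h2 := formIntegral_laplacian_eq_zero (σ := σ) hσs
    (f.contMDiff_log_sqNormAt_add hF hL g h hε)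
  rw [formIntegral_eq_sum hI] at h2
  rw [h2, zero_sub]

theorem Hom.IsSheafMono.tendsto_curvTerm [CompactSpace X] [IsManifold 𝓘(ℂ, ℂ) ω X]
    {f : Hom F L} (hf : f.IsSheafMono) (hF : F.rank = 1) (hL : L.rank = 1)
    (g : HermitianMetric F) (h : HermitianMetric L) {η : X → ℝ} {i : X} (hη : Continuous η)
    (hηS : tsupport η ⊆ F.patch i ∩ L.patch i) :
    Tendsto (fun ε => ∫ z in (chartAt ℂ i).target, f.curvTerm hF g h η ε i z) (𝓝[>] 0)
      (𝓝 (∫ z in (chartAt ℂ i).target, η ((chartAt ℂ i).symm z) * curvDiff g h i z)) := by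
  have hint0 : IntegrableOn (fun z => η ((chartAt ℂ i).symm z) * curvDiff g h i z)
      (chartAt ℂ i).target :=
    integrableOn_mul_of_tsupport (S := F.patch i ∩ L.patch i) (fun x hx => hx.1.1) hη hηS
      (continuousOn_curvDiff hF hL g h i)
  refine tendsto_integral_filter_of_dominated_convergence
    (fun z => ‖η ((chartAt ℂ i).symm z) * curvDiff g h i z‖) ?_ ?_ hint0.norm ?_
  · filter_upwards [self_mem_nhdsWithin] with ε hε
    exact (f.integrableOn_curvTerm hF hL g h hη hηS hε).aestronglyMeasurable
  · filter_upwards [self_mem_nhdsWithin] with ε hε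
    refine Eventually.of_forall fun z => ?_
    have hε' : (0 : ℝ) < ε := hε
    have h1 := f.sqNormAt_nonneg hF hL g h ((chartAt ℂ i).symm z)
    unfold Hom.curvTerm
    set t := f.sqNormAt hF g h ((chartAt ℂ i).symm z)
    have h2 : ‖t / (t + ε)‖ ≤ 1 := by
      rw [Real.norm_of_nonneg (by positivity), div_le_one (by positivity)]
      linarith
    rw [norm_mul, norm_mul, norm_mul]
    exact mul_le_mul_of_nonneg_right (mul_le_of_le_one_right (norm_nonneg _) h2) (norm_nonneg _)
  · rw [ae_restrict_iff' (chartAt ℂ i).open_target.measurableSet]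
    filter_upwards [hf.ae_localCoef_ne_zero hF hL i] with z hz hzt
    unfold Hom.curvTerm
    by_cases h0 : η ((chartAt ℂ i).symm z) = 0
    · simp [h0]
    have hzV : z ∈ chartImage i (F.patch i ∩ L.patch i) := ⟨hzt, hηS (subset_tsupport _ h0)⟩
    have hpos : 0 < f.sqNormAt hF g h ((chartAt ℂ i).symm z) := by
      rw [f.sqNormAt_chart hF hL g h hzV]
      exact sqNorm_pos _ _ (hz hzV)
    set t := f.sqNormAt hF g h ((chartAt ℂ i).symm z)
    have h3 : Tendsto (fun ε : ℝ => t / (t + ε)) (𝓝[>] 0) (𝓝 1) := by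
      have : ContinuousAt (fun ε : ℝ => t / (t + ε)) 0 :=
        continuousAt_const.div (by fun_prop) (by simpa using hpos.ne')
      have h4 := this.tendsto
      rw [add_zero, div_self hpos.ne'] at h4
      exact h4.mono_left nhdsWithin_le_nhds
    simpa using (h3.const_mul (η ((chartAt ℂ i).symm z))).mul_const (curvDiff g h i z)

/-- Since the integral of the Laplacian of `log (u + ε)` vanishes, the integrals of its gradient
terms converge to minus the integral of the difference of the curvatures as `ε → 0`. -/
theorem Hom.IsSheafMono.tendsto_sum_gradTerm [T2Space X] [CompactSpace X]
    [IsManifold 𝓘(ℂ, ℂ) ω X] {f : Hom F L} (hf : f.IsSheafMono) (hF : F.rank = 1)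
    (hL : L.rank = 1) (g : HermitianMetric F) (h : HermitianMetric L)
    {σ : SmoothPartitionOfUnity X 𝓘(ℝ, ℂ) X univ}
    (hσ : σ.IsSubordinate fun i => F.patch i ∩ L.patch i) {I : Finset X}
    (hI : ∀ i ∉ I, ∀ x, σ i x = 0) :
    Tendsto (fun ε => ∑ i ∈ I, ∫ z in (chartAt ℂ i).target, σ i ((chartAt ℂ i).symm z) *
      f.gradTerm hF hL g h ε i z) (𝓝[>] 0) (𝓝 (-formIntegral σ (curvDiff g h))) := by
  rw [formIntegral_eq_sum hI]
  refine (tendsto_finsetSum I fun i _ =>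
    hf.tendsto_curvTerm hF hL g h (σ i).contMDiff.continuous (hσ i)).neg.congr' ?_
  filter_upwards [self_mem_nhdsWithin] with ε hε
  exact (hf.sum_gradTerm_eq hF hL g h hσ hI hε).symm

/-- The difference of the degrees, as the integral of the difference of the Chern forms over a common
partition of unity. -/
theorem chernNumber_sub_eq [T2Space X] [CompactSpace X] [IsManifold 𝓘(ℂ, ℂ) ω X] (hF : F.rank = 1) (hL : L.rank = 1) (g : HermitianMetric F)
    (h : HermitianMetric L) {ρF ρL σ : SmoothPartitionOfUnity X 𝓘(ℝ, ℂ) X univ}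
    (hρF : ρF.IsSubordinate F.patch) (hρL : ρL.IsSubordinate L.patch)
    (hσ : σ.IsSubordinate fun i => F.patch i ∩ L.patch i) :
    h.chernNumber ρL - g.chernNumber ρF =
      1 / (4 * Real.pi) * -formIntegral σ (curvDiff g h) := by
  obtain ⟨I, hI, -⟩ := exists_finset_partition σ
  have hσc : ∀ i, Continuous (σ i) := fun i => (σ i).contMDiff.continuous
  have hS : ∀ i, F.patch i ∩ L.patch i ⊆ (chartAt ℂ i).source := fun i x hx => hx.1.1
  rw [h.chernNumber_eq, g.chernNumber_eq,
    h.formIntegral_weight_congr hL (fun _ => inter_subset_right) hρL hσ,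
    g.formIntegral_weight_congr hF (fun _ => inter_subset_left) hρF hσ]
  have : formIntegral σ (curvDiff g h) =
      formIntegral σ (fun i => Laplacian.laplacian (h.weight i)) -
      formIntegral σ (fun i => Laplacian.laplacian (g.weight i)) := by
    rw [formIntegral_eq_sum hI, formIntegral_eq_sum hI, formIntegral_eq_sum hI,
      ← Finset.sum_sub_distrib]
    refine Finset.sum_congr rfl fun i _ => ?_
    rw [← integral_sub]
    · refine integral_congr_ae (Eventually.of_forall fun z => ?_)
      exact mul_sub _ _ _
    · exact integrableOn_mul_of_tsupport (hS i) (hσc i) (hσ i)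
        ((h.continuousOn_laplacian_weight hL i).mono fun _ hz => ⟨hz.1, hz.2.2⟩)
    · exact integrableOn_mul_of_tsupport (hS i) (hσc i) (hσ i)
        ((g.continuousOn_laplacian_weight hF i).mono fun _ hz => ⟨hz.1, hz.2.1⟩)
  rw [this]; ring

/-- A line bundle which is a subsheaf of another line bundle has at most the same degree. -/
theorem Hom.IsSheafMono.degree_le [T2Space X] [CompactSpace X] [IsManifold 𝓘(ℂ, ℂ) ω X] {f : Hom F L} (hf : f.IsSheafMono) (hF : F.rank = 1)
    (hL : L.rank = 1) : F.degree ≤ L.degree := by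
  obtain ⟨g, ρF, hρF, hgF⟩ := F.exists_degree_eq
  obtain ⟨h, ρL, hρL, hhL⟩ := L.exists_degree_eq
  obtain ⟨σ, hσ⟩ := exists_partition_subordinate (S := fun i => F.patch i ∩ L.patch i)
    (fun i => (F.isOpen_patch i).inter (L.isOpen_patch i)) fun i => ⟨F.mem_patch i, L.mem_patch i⟩
  obtain ⟨I, hI, -⟩ := exists_finset_partition σ
  have hsub := chernNumber_sub_eq hF hL g h hρF hρL hσ
  have hlim := hf.tendsto_sum_gradTerm hF hL g h hσ hI
  have hnn : 0 ≤ -formIntegral σ (curvDiff g h) := by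
    refine ge_of_tendsto hlim ?_
    filter_upwards [self_mem_nhdsWithin] with ε hε
    exact Finset.sum_nonneg fun i _ => integral_nonneg fun z =>
      mul_nonneg (σ.nonneg i _) (f.gradTerm_nonneg hF hL g h hε i z)
  rw [hgF, hhL]
  have : 0 ≤ 1 / (4 * Real.pi) * -formIntegral σ (curvDiff g h) :=
    mul_nonneg (by positivity) hnn
  linarith

/-- If moreover the inclusion vanishes in some fiber, the degree is strictly smaller. -/
theorem Hom.IsSheafMono.degree_lt [T2Space X] [CompactSpace X] [IsManifold 𝓘(ℂ, ℂ) ω X] {f : Hom F L} (hf : f.IsSheafMono) (hF : F.rank = 1)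
    (hL : L.rank = 1) {p : X} (hp : f.toFun p = 0) : F.degree < L.degree := by
  obtain ⟨g, ρF, hρF, hgF⟩ := F.exists_degree_eq
  obtain ⟨h, ρL, hρL, hhL⟩ := L.exists_degree_eq
  obtain ⟨σ, hσ⟩ := exists_partition_subordinate (S := fun i => F.patch i ∩ L.patch i)
    (fun i => (F.isOpen_patch i).inter (L.isOpen_patch i)) fun i => ⟨F.mem_patch i, L.mem_patch i⟩
  obtain ⟨I, hI, -⟩ := exists_finset_partition σ
  have hsub := chernNumber_sub_eq hF hL g h hρF hρL hσ
  have hlim := hf.tendsto_sum_gradTerm hF hL g h hσ hI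
  obtain ⟨i, hi⟩ := σ.exists_pos_of_mem (mem_univ p)
  have hiI : i ∈ I := by
    by_contra hni
    exact hi.ne' (hI i hni p)
  have hpS : p ∈ F.patch i ∩ L.patch i := hσ i (subset_tsupport _ hi.ne')
  set e := chartAt ℂ i with he
  have hpe : p ∈ e.source := hpS.1.1
  set z₀ := e p with hz₀
  have hz₀V : z₀ ∈ chartImage i (F.patch i ∩ L.patch i) :=
    ⟨e.map_source hpe, by rw [mem_preimage, ← he, hz₀, e.left_inv hpe]; exact hpS⟩
  have hc0 : f.localCoef hF hL i z₀ = 0 := by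
    rw [Hom.localCoef, ← he, hz₀, e.left_inv hpe, Hom.coef, hp]
    simp
  obtain ⟨δ, hδ, m, hm, hbound⟩ := exists_gradient_term_lower_bound
    (f.analyticAt_localCoef hF hL hz₀V) hc0 (hf.localCoef_not_eventually_zero hF hL hz₀V)
    (h.contDiffAt_weight hL ⟨hz₀V.1, hz₀V.2.2.2⟩) (g.contDiffAt_weight hF ⟨hz₀V.1, hz₀V.2.1.2⟩)
  set a := σ i p with ha
  have hσnear : ∀ᶠ z in 𝓝 z₀, z ∈ e.target ∧ a / 2 < σ i (e.symm z) := by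
    refine (e.open_target.eventually_mem hz₀V.1).and ?_
    have hcont : ContinuousAt (fun z => σ i (e.symm z)) z₀ :=
      (σ i).contMDiff.continuous.continuousAt.comp (e.continuousAt_symm hz₀V.1)
    refine continuousAt_const.eventually_lt hcont ?_
    rw [hz₀, e.left_inv hpe]
    linarith
  obtain ⟨R, hR, hRnear⟩ := Metric.eventually_nhds_iff.1 hσnear
  have hpow : Tendsto (fun r : ℝ => r ^ (2 * m)) (𝓝[>] 0) (𝓝[>] 0) := by
    refine tendsto_nhdsWithin_iff.2 ⟨?_, ?_⟩
    · have : ContinuousAt (fun r : ℝ => r ^ (2 * m)) 0 := by fun_prop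
      have h1 := this.tendsto
      rw [zero_pow (by omega)] at h1
      exact h1.mono_left nhdsWithin_le_nhds
    · filter_upwards [self_mem_nhdsWithin] with r hr
      exact pow_pos (show (0 : ℝ) < r from hr) _
  -- the constant is the area `π r² / 16` of the disc times the lower bound `a / 2 * δ / r²`
  have hpos : a * δ * Real.pi / 32 ≤ -formIntegral σ (curvDiff g h) := by
    refine ge_of_tendsto (hlim.comp hpow) ?_
    filter_upwards [hbound, Ioo_mem_nhdsGT hR] with r hr hrR
    have hr0 : 0 < r := hrR.1
    have hε : 0 < r ^ (2 * m) := by positivity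
    have hterm : a * δ * Real.pi / 32 ≤ ∫ z in e.target, σ i (e.symm z) *
        f.gradTerm hF hL g h (r ^ (2 * m)) i z := by
      -- a disc of radius `r / 4` inside the annulus `r / 2 ≤ |z - z₀| ≤ r`
      set B := Metric.ball (z₀ + (3 * r / 4 : ℝ)) (r / 4) with hB
      have hBann : ∀ z ∈ B, r / 2 ≤ ‖z - z₀‖ ∧ ‖z - z₀‖ ≤ r := by
        intro z hz
        rw [hB, Metric.mem_ball, dist_eq_norm] at hz
        have hn : ‖((3 * r / 4 : ℝ) : ℂ)‖ = 3 * r / 4 := by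
          rw [Complex.norm_real, Real.norm_of_nonneg (by positivity)]
        have e1 : z - z₀ = (z - (z₀ + (3 * r / 4 : ℝ))) + (3 * r / 4 : ℝ) := by ring
        have e2 := norm_add_le (z - (z₀ + (3 * r / 4 : ℝ))) ((3 * r / 4 : ℝ) : ℂ)
        have e3 := norm_sub_le (z - z₀) (z - (z₀ + (3 * r / 4 : ℝ)))
        have e4 : (z - z₀) - (z - (z₀ + (3 * r / 4 : ℝ))) = (3 * r / 4 : ℝ) := by ring
        rw [← e1, hn] at e2
        rw [e4, hn] at e3
        constructor <;> linarith
      have hint := hf.integrableOn_gradTerm hF hL g h (σ i).contMDiff.continuous (hσ i) hε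
      have hBnear : ∀ z ∈ B, z ∈ e.target ∧ a / 2 < σ i (e.symm z) := fun z hz =>
        hRnear (by rw [dist_eq_norm]; exact (hBann z hz).2.trans_lt hrR.2)
      have hvol : volume.real B = Real.pi * r ^ 2 / 16 := by
        rw [hB, Measure.real, Complex.volume_ball, ENNReal.toReal_mul, ENNReal.toReal_pow,
          ENNReal.toReal_ofReal (by positivity), ENNReal.coe_toReal, NNReal.coe_real_pi]
        ring
      calc a * δ * Real.pi / 32 = a / 2 * (δ / r ^ 2) * volume.real B := by
            rw [hvol]; field_simp; ring
        _ ≤ ∫ z in B, σ i (e.symm z) * f.gradTerm hF hL g h (r ^ (2 * m)) i z := by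
            refine setIntegral_ge_of_const_le_real measurableSet_ball measure_ball_lt_top.ne ?_
              (hint.mono_set fun z hz => (hBnear z hz).1)
            intro z hz
            exact mul_le_mul (hBnear z hz).2.le (hr z (hBann z hz).1 (hBann z hz).2)
              (by positivity) (σ.nonneg i _)
        _ ≤ _ := setIntegral_mono_set hint
            (Eventually.of_forall fun z => mul_nonneg (σ.nonneg i _)
              (f.gradTerm_nonneg hF hL g h hε i z))
            (Eventually.of_forall fun z hz => (hBnear z hz).1)
    refine hterm.trans ?_
    exact Finset.single_le_sum (f := fun i => ∫ z in (chartAt ℂ i).target,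
        σ i ((chartAt ℂ i).symm z) * f.gradTerm hF hL g h (r ^ (2 * m)) i z)
      (fun j _ => integral_nonneg fun z =>
        mul_nonneg (σ.nonneg j _) (f.gradTerm_nonneg hF hL g h hε j z)) hiI
  have hpos' : 0 < -formIntegral σ (curvDiff g h) := lt_of_lt_of_le (by positivity) hpos
  rw [hgF, hhL]
  have : 0 < 1 / (4 * Real.pi) * -formIntegral σ (curvDiff g h) :=
    mul_pos (by positivity) hpos'
  linarith

end Comparison

/-! ### Homomorphisms of line bundles -/

section Homs

variable {X : Type u} [TopologicalSpace X] [ChartedSpace ℂ X] {E F L : HolBundle X}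

theorem HolBundle.subsingleton_fiber (hE : E.rank = 0) (x : X) : Subsingleton (E.fiber x) := by
  have : IsEmpty (Fin E.rank) := by rw [hE]; infer_instance
  exact ⟨fun v w => E.coord_injective (E.mem_base x) (Subsingleton.elim _ _)⟩

/-- A homomorphism from a line bundle vanishes at a point where it kills a frame. -/
theorem Hom.toFun_eq_zero (f : Hom E F) (hE : E.rank = 1) {x₀ x : X} (hx : x ∈ E.base x₀)
    (h : f.toFun x (E.frame x₀ (lineIndex hE) x) = 0) : f.toFun x = 0 := by
  ext v
  rw [← E.sum_coord_smul_frame hx v, sum_lineIndex hE, map_smul, h, smul_zero,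
    LinearMap.zero_apply]

theorem Hom.toFun_eq_zero_iff (f : Hom E F) (hE : E.rank = 1) (hF : F.rank = 1) {x₀ x : X}
    (hxE : x ∈ E.base x₀) (hxF : x ∈ F.base x₀) :
    f.toFun x = 0 ↔ f.coef x₀ x₀ (lineIndex hE) (lineIndex hF) x = 0 := by
  constructor
  · intro h
    simp [Hom.coef, h]
  · intro h
    exact f.toFun_eq_zero hE hxE (by rw [f.map_frame_line hE hF hxF, h, zero_smul])

/-- The identity theorem for homomorphisms of line bundles. -/
theorem Hom.eq_zero_of_eventually [PreconnectedSpace X] [IsManifold 𝓘(ℂ, ℂ) ω X] (f : Hom E F)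
    (hE : E.rank = 1) (hF : F.rank = 1) {y : X} (hy : ∀ᶠ x in 𝓝 y, f.toFun x = 0) : f = 0 := by
  set Z : Set X := {x | ∀ᶠ x' in 𝓝 x, f.toFun x' = 0} with hZ
  have hopen : IsOpen Z := isOpen_iff_mem_nhds.2 fun x hx => eventually_eventually_nhds.2 hx
  have hclosed : IsClosed Z := by
    rw [isClosed_iff_frequently]
    intro x hx
    set e := chartAt ℂ x with he
    have hxs : x ∈ e.source := mem_chart_source ℂ x
    have hsymm : e.symm (e x) = x := e.left_inv hxs
    have hV : e x ∈ chartImage x (E.patch x ∩ F.patch x) :=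
      ⟨e.map_source hxs, by
        rw [mem_preimage, ← he, hsymm]; exact ⟨E.mem_patch x, F.mem_patch x⟩⟩
    have hVo := isOpen_chartImage x ((E.isOpen_patch x).inter (F.isOpen_patch x))
    have hmap : map e.symm (𝓝 (e x)) = 𝓝 x := by
      rw [e.symm.map_nhds_eq (e.map_source hxs), hsymm]
    have hiff : ∀ w ∈ chartImage x (E.patch x ∩ F.patch x),
        f.toFun (e.symm w) = 0 ↔ f.localCoef hE hF x w = 0 := fun w hw =>
      f.toFun_eq_zero_iff hE hF hw.2.1.2 hw.2.2.2
    rcases (f.analyticAt_localCoef hE hF hV).eventually_eq_zero_or_eventually_ne_zero with h | h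
    · rw [hZ, mem_ofPred_eq, ← hmap, eventually_map]
      filter_upwards [h, hVo.mem_nhds hV] with w hw hwV
      exact (hiff w hwV).2 hw
    · exfalso
      rw [eventually_nhdsWithin_iff] at h
      rw [← hmap, frequently_map] at hx
      obtain ⟨w, hwZ, hw1, hwV⟩ := (hx.and_eventually
        (h.eventually_nhds.and (hVo.eventually_mem hV))).exists
      rw [hZ, mem_ofPred_eq, ← e.symm.map_nhds_eq hwV.1, eventually_map] at hwZ
      have hsing : ∀ᶠ w' in 𝓝 w, w' = e x := by
        filter_upwards [hwZ, hw1, hVo.mem_nhds hwV] with w' h1 h2 h3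
        by_contra hne
        exact h2 hne ((hiff w' h3).1 h1)
      have hw : w = e x := hsing.self_of_nhds
      have hne : ∀ᶠ w' in 𝓝[≠] w, False := by
        rw [eventually_nhdsWithin_iff]
        filter_upwards [hsing] with w' h1 h2
        exact h2 (h1.trans hw.symm)
      exact hne.exists.elim fun _ h => h
  have huniv : Z = univ := IsClopen.eq_univ ⟨hclosed, hopen⟩ ⟨y, hy⟩
  apply Hom.ext
  funext x
  exact (huniv ▸ mem_univ x : x ∈ Z).self_of_nhds

/-- A homomorphism of line bundles which is injective on sections is nonzero on the fibers over a
nonempty open set. -/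
theorem Hom.IsSheafMono.exists_eventually_ne_zero {f : Hom F L} (hf : f.IsSheafMono)
    (hF : F.rank = 1) (hL : L.rank = 1) [Nonempty X] :
    ∃ y i : X, ∀ᶠ x in 𝓝 y, x ∈ F.base i ∧ x ∈ L.base i ∧
      f.coef i i (lineIndex hF) (lineIndex hL) x ≠ 0 := by
  obtain ⟨i⟩ := ‹Nonempty X›
  have hopen := (F.isOpen_base i).inter (L.isOpen_base i)
  have hi : i ∈ F.base i ∩ L.base i := ⟨F.mem_base i, L.mem_base i⟩
  obtain ⟨y, hy, hyB⟩ := ((not_eventually.1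
    (hf.coef_not_eventually_zero hF hL hi.1 hi.2)).and_eventually (hopen.eventually_mem hi)).exists
  have hcont := ((f.contMDiffOn_coef i i (lineIndex hF) (lineIndex hL)).contMDiffAt
    (hopen.mem_nhds hyB)).continuousAt
  refine ⟨y, i, ?_⟩
  filter_upwards [hopen.mem_nhds hyB, hcont.eventually_ne hy] with x hx hne
  exact ⟨hx.1, hx.2, hne⟩

/-- A vector bundle which is a subsheaf of a line bundle has rank at most one: two sections `s`,
`t` of it with images `a` and `b` satisfy the relation `b s - a t = 0`. -/
theorem Hom.IsSheafMono.rank_le_one {f : Hom F L} (hf : f.IsSheafMono) (hL : L.rank = 1)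
    [Nonempty X] : F.rank ≤ 1 := by
  by_contra hcon
  obtain ⟨i⟩ := ‹Nonempty X›
  set j₀ : Fin F.rank := ⟨0, by omega⟩
  set j₁ : Fin F.rank := ⟨1, by omega⟩
  have hj : j₀ ≠ j₁ := by simp [j₀, j₁]
  set a := f.coef i i j₀ (lineIndex hL)
  set b := f.coef i i j₁ (lineIndex hL)
  set U := F.base i ∩ L.base i
  have hU : IsOpen U := (F.isOpen_base i).inter (L.isOpen_base i)
  have hmap : ∀ j, ∀ x ∈ U, f.toFun x (F.frame i j x) =
      f.coef i i j (lineIndex hL) x • L.frame i (lineIndex hL) x := fun j x hx => by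
    rw [f.map_frame hx.2, sum_lineIndex hL]
  have hs : F.IsHolSection U (fun x => b x • F.frame i j₀ x - a x • F.frame i j₁ x) :=
    ((f.contMDiffOn_coef i i j₁ (lineIndex hL)).smul_section
      ((F.isHolSection_frame i j₀).mono inter_subset_left)).sub_section
    ((f.contMDiffOn_coef i i j₀ (lineIndex hL)).smul_section
      ((F.isHolSection_frame i j₁).mono inter_subset_left))
  have h0 := hf U _ hU hs fun x hx => by
    rw [map_sub, map_smul, map_smul, hmap _ x hx, hmap _ x hx, smul_smul, smul_smul, mul_comm,
      sub_self]
  have ha : ∀ x ∈ U, a x = 0 := by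
    intro x hx
    have h1 := congrArg (fun v => F.coord i x v j₁) (h0 x hx)
    simpa [F.coord_frame hx.1, hj, hj.symm] using h1
  have hi : i ∈ U := ⟨F.mem_base i, L.mem_base i⟩
  refine F.frame_ne_zero hi.1 j₀ (hf U (F.frame i j₀) hU
    ((F.isHolSection_frame i j₀).mono inter_subset_left) (fun x hx => ?_) i hi)
  have := ha x hx
  rw [hmap _ x hx, show f.coef i i j₀ (lineIndex hL) x = 0 from this, zero_smul]

/-- A homomorphism of line bundles which vanishes in no fiber is an isomorphism. -/
theorem Hom.isIso_of_forall_ne_zero (f : Hom F L) (hF : F.rank = 1) (hL : L.rank = 1)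
    (h : ∀ x, f.toFun x ≠ 0) : f.IsIso := by
  have hne : ∀ {i x : X}, x ∈ F.base i → x ∈ L.base i →
      f.coef i i (lineIndex hF) (lineIndex hL) x ≠ 0 := fun hxF hxL h0 =>
    h _ ((f.toFun_eq_zero_iff hF hL hxF hxL).2 h0)
  have hv : ∀ {i x : X}, x ∈ F.base i → x ∈ L.base i → ∀ v, f.toFun x v =
      (F.coord i x v (lineIndex hF) * f.coef i i (lineIndex hF) (lineIndex hL) x) •
        L.frame i (lineIndex hL) x := by
    intro i x hxF hxL v
    conv_lhs => rw [← F.sum_coord_smul_frame hxF v, sum_lineIndex hF, map_smul,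
      f.map_frame_line hF hL hxL, smul_smul]
  have hinj : ∀ x, Function.Injective (f.toFun x) := by
    intro x
    rw [injective_iff_map_eq_zero]
    intro v hv0
    rw [hv (F.mem_base x) (L.mem_base x), smul_eq_zero,
      or_iff_left (L.frame_ne_zero (L.mem_base x) _), mul_eq_zero,
      or_iff_left (hne (F.mem_base x) (L.mem_base x))] at hv0
    rw [← F.sum_coord_smul_frame (F.mem_base x) v, sum_lineIndex hF, hv0, zero_smul]
  have hinv : ∀ {i x : X}, x ∈ F.base i → x ∈ L.base i → ∀ w,
      f.toFun x (((f.coef i i (lineIndex hF) (lineIndex hL) x)⁻¹ *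
        L.coord i x w (lineIndex hL)) • F.frame i (lineIndex hF) x) = w := by
    intro i x hxF hxL w
    rw [map_smul, f.map_frame_line hF hL hxL, smul_smul, mul_comm, ← mul_assoc,
      mul_inv_cancel₀ (hne hxF hxL), one_mul]
    conv_rhs => rw [← L.sum_coord_smul_frame hxL w, sum_lineIndex hL]
  have hsurj : ∀ x, Function.Surjective (f.toFun x) := fun x w =>
    ⟨_, hinv (F.mem_base x) (L.mem_base x) w⟩
  set e : ∀ x, F.fiber x ≃ₗ[ℂ] L.fiber x := fun x =>
    LinearEquiv.ofBijective (f.toFun x) ⟨hinj x, hsurj x⟩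
  have he : ∀ {i x : X}, x ∈ F.base i → x ∈ L.base i → ∀ w, (e x).symm w =
      ((f.coef i i (lineIndex hF) (lineIndex hL) x)⁻¹ * L.coord i x w (lineIndex hL)) •
        F.frame i (lineIndex hF) x := fun {i x} hxF hxL w => by
    rw [LinearEquiv.symm_apply_eq]
    exact (hinv hxF hxL w).symm
  refine ⟨⟨fun x => (e x).symm, ?_⟩, fun x v => (e x).symm_apply_apply v,
    fun x w => (e x).apply_symm_apply w⟩
  rintro ⟨i, w⟩
  rw [contMDiffAt_totalSpace]
  refine ⟨contMDiffAt_proj L.fiber, ?_⟩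
  have hproj : ContMDiffAt (𝓘(ℂ, ℂ).prod 𝓘(ℂ, L.Model)) 𝓘(ℂ, ℂ) ω
      (fun p : L.Total => p.1) (⟨i, w⟩ : L.Total) := contMDiffAt_proj L.fiber
  have hi : i ∈ F.base i ∩ L.base i := ⟨F.mem_base i, L.mem_base i⟩
  have hopen := (F.isOpen_base i).inter (L.isOpen_base i)
  have hc : ContMDiffAt (𝓘(ℂ, ℂ).prod 𝓘(ℂ, L.Model)) 𝓘(ℂ, ℂ) ω
      (fun p : L.Total => f.coef i i (lineIndex hF) (lineIndex hL) p.1) (⟨i, w⟩ : L.Total) :=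
    ContMDiffAt.comp (⟨i, w⟩ : L.Total)
      ((f.contMDiffOn_coef i i (lineIndex hF) (lineIndex hL)).contMDiffAt (hopen.mem_nhds hi))
      hproj
  have hw : ContMDiffAt (𝓘(ℂ, ℂ).prod 𝓘(ℂ, L.Model)) 𝓘(ℂ, L.Model) ω
      (fun p : L.Total => (trivializationAt L.Model L.fiber i p).2) (⟨i, w⟩ : L.Total) :=
    (contMDiffAt_totalSpace.1 (contMDiffAt_id (x := (⟨i, w⟩ : L.Total)))).2
  have hΨ : ContDiffAt ℂ ω (fun q : ℂ × L.Model =>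
      (q.1⁻¹ * q.2 (lineIndex hL)) • (Pi.single (lineIndex hF) 1 : F.Model))
      (f.coef i i (lineIndex hF) (lineIndex hL) i,
        (trivializationAt L.Model L.fiber i ⟨i, w⟩).2) := by
    have h1 : ContDiff ℂ ω (fun v : L.Model => v (lineIndex hL)) :=
      (ContinuousLinearMap.proj (R := ℂ) (φ := fun _ : Fin L.rank => ℂ) (lineIndex hL)).contDiff
    exact ((contDiffAt_fst.inv (hne hi.1 hi.2)).mul (h1.contDiffAt.comp _ contDiffAt_snd)).smul
      contDiffAt_const
  have hcomp := hΨ.contMDiffAt.comp (⟨i, w⟩ : L.Total) (hc.prodMk_space hw)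
  refine hcomp.congr_of_eventuallyEq ?_
  have hnear : ∀ᶠ p in 𝓝 (⟨i, w⟩ : L.Total), p.1 ∈ F.base i ∩ L.base i :=
    hproj.continuousAt.eventually_mem (hopen.mem_nhds hi)
  filter_upwards [hnear] with p hp
  have h2 := F.coord_apply hp.1 ((e p.1).symm p.2)
  simp only [Function.comp_apply]
  refine h2.symm.trans ?_
  rw [he hp.1 hp.2, map_smul, F.coord_frame hp.1, L.coord_apply hp.2]

end Homs

/-! ### Subchains and slopes -/

section Chains

variable {X : Type u} [TopologicalSpace X] [ChartedSpace ℂ X] {n : ℕ}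

theorem Hom.isSheafMono_id (E : HolBundle X) : (Hom.id E).IsSheafMono := fun _ _ _ _ h => h

/-- The inclusion of a truncated bundle. -/
def Hom.truncIncl (E : HolBundle X) : ∀ b, Hom (E.trunc b) E
  | true => Hom.id E
  | false => 0

theorem Hom.isSheafMono_truncIncl (E : HolBundle X) :
    ∀ b, (Hom.truncIncl E b).IsSheafMono
  | true => Hom.isSheafMono_id E
  | false => fun _ _ _ _ _ x _ =>
    (HolBundle.subsingleton_fiber (E := HolBundle.zero X) rfl x).elim _ _

theorem HolBundle.rank_trunc (E : HolBundle X) (b : Bool) :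
    (E.trunc b).rank = if b then E.rank else 0 := by
  cases b <;> rfl

theorem HolBundle.degree_trunc [T2Space X] [CompactSpace X] [IsManifold 𝓘(ℂ, ℂ) ω X]
    (E : HolBundle X) (b : Bool) : (E.trunc b).degree = if b then E.degree else 0 := by
  cases b
  · exact (HolBundle.zero X).degree_eq_zero rfl
  · rfl

namespace Chain

/-- The chain obtained from `C` by replacing the bundles at which `b` is false by zero. -/
def truncate (C : Chain X n) (b : Fin (n + 1) → Bool) : Chain X n where
  E k := (C.E k).trunc (b k)
  φ k := (C.φ k).trunc (b k.succ) (b k.castSucc)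

theorem standardSubchain_eq (C : Chain X n) (i : Fin n) :
    C.standardSubchain i = C.truncate fun k => decide (k ≤ i.castSucc) := rfl

theorem isSubchain_truncate (C : Chain X n) {b : Fin (n + 1) → Bool}
    (hb : ∀ k : Fin n, b k.succ = true → b k.castSucc = true ∨ C.φ k = 0) :
    IsSubchain (C.truncate b) C fun k => Hom.truncIncl (C.E k) (b k) where
  mono k := Hom.isSheafMono_truncIncl _ _
  comm k x := by
    have hk := hb k
    have key : ∀ b₁ b₀ : Bool, (b₁ = true → b₀ = true ∨ C.φ k = 0) →
        ∀ v : ((C.E k.succ).trunc b₁).fiber x,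
        (Hom.truncIncl (C.E k.castSucc) b₀).toFun x (((C.φ k).trunc b₁ b₀).toFun x v) =
          (C.φ k).toFun x ((Hom.truncIncl (C.E k.succ) b₁).toFun x v) := by
      rintro (_ | _) (_ | _) h v
      · exact (map_zero ((C.φ k).toFun x)).symm
      · exact (map_zero ((C.φ k).toFun x)).symm
      · rcases h rfl with h | h
        · exact absurd h (by decide)
        · change _ = (C.φ k).toFun x v
          rw [h]
          rfl
      · rfl
    exact key _ _ hk

theorem not_isIso_truncIncl_false [Nonempty X] {E : HolBundle X} (hE : E.rank ≠ 0) :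
    ¬ (Hom.truncIncl E false).IsIso := by
  rintro ⟨g, -, hg⟩
  obtain ⟨x⟩ := ‹Nonempty X›
  set j : Fin E.rank := ⟨0, Nat.pos_of_ne_zero hE⟩
  have h := hg x (E.frame x j x)
  exact E.frame_ne_zero (E.mem_base x) j h.symm

/-- The numerator of the slope. -/
def slopeNum (C : Chain X n) (α : Fin n → ℝ) : ℝ :=
  ∑ i, (C.E i).degree + ∑ i : Fin n, α i * ((C.E i.succ).rank : ℝ)

/-- The denominator of the slope. -/
def totalRank (C : Chain X n) : ℝ := ∑ i, ((C.E i).rank : ℝ)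

theorem slope_eq (C : Chain X n) (α : Fin n → ℝ) : C.slope α = C.slopeNum α / C.totalRank := rfl

theorem totalRank_pos {C : Chain X n} {i : Fin (n + 1)} (hi : (C.E i).rank ≠ 0) :
    0 < C.totalRank :=
  Finset.sum_pos' (fun _ _ => Nat.cast_nonneg _)
    ⟨i, Finset.mem_univ i, by exact_mod_cast Nat.pos_of_ne_zero hi⟩

theorem totalRank_truncate_add (C : Chain X n) (b : Fin (n + 1) → Bool) :
    (C.truncate b).totalRank + (C.truncate fun k => !b k).totalRank = C.totalRank := by
  simp only [totalRank, ← Finset.sum_add_distrib]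
  refine Finset.sum_congr rfl fun i _ => ?_
  simp only [truncate, HolBundle.rank_trunc]
  cases b i <;> simp

theorem slope_le_slope {C D : Chain X n} (α : Fin n → ℝ)
    (hr : ∀ i, (D.E i).rank = (C.E i).rank) (hd : ∀ i, (D.E i).degree ≤ (C.E i).degree) :
    D.slope α ≤ C.slope α := by
  have h1 : D.totalRank = C.totalRank := by simp only [totalRank, hr]
  have h2 : D.slopeNum α ≤ C.slopeNum α := by
    simp only [slopeNum, hr]
    exact add_le_add_left (Finset.sum_le_sum fun i _ => hd i) _
  have h3 : 0 ≤ C.totalRank := Finset.sum_nonneg fun _ _ => Nat.cast_nonneg _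
  rw [slope_eq, slope_eq, h1]
  exact div_le_div_of_nonneg_right h2 h3

theorem slope_lt_slope {C D : Chain X n} (α : Fin n → ℝ)
    (hr : ∀ i, (D.E i).rank = (C.E i).rank) (hd : ∀ i, (D.E i).degree ≤ (C.E i).degree)
    {i : Fin (n + 1)} (hi : (D.E i).degree < (C.E i).degree) (hi0 : (C.E i).rank ≠ 0) :
    D.slope α < C.slope α := by
  have h1 : D.totalRank = C.totalRank := by simp only [totalRank, hr]
  have h2 : D.slopeNum α < C.slopeNum α := by
    simp only [slopeNum, hr]
    exact add_lt_add_left (Finset.sum_lt_sum (fun i _ => hd i) ⟨i, Finset.mem_univ i, hi⟩) _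
  rw [slope_eq, slope_eq, h1]
  exact div_lt_div_of_pos_right h2 (totalRank_pos hi0)

/-- A nonempty proper initial segment of `0, …, n` is `0, …, i` for some `i < n`. -/
theorem exists_iff_le_castSucc {s : Fin (n + 1) → Prop}
    (hs : ∀ k : Fin n, s k.succ → s k.castSucc) (h1 : ∃ k, s k) (h0 : ¬ ∀ k, s k) :
    ∃ i : Fin n, ∀ k, s k ↔ k ≤ i.castSucc := by
  have hdown : ∀ m : ℕ, ∀ k l : Fin (n + 1), (l : ℕ) + m = k → s k → s l := by
    intro m
    induction m with
    | zero => intro k l h hk; rwa [show l = k from Fin.ext (by simpa using h)]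
    | succ m ih =>
      intro k l h hk
      refine ih ⟨l + m, by omega⟩ l rfl (hs ⟨l + m, by omega⟩ ?_)
      rwa [show Fin.succ ⟨(l : ℕ) + m, by omega⟩ = k from Fin.ext (by simp; omega)]
  have hmono : ∀ k l : Fin (n + 1), l ≤ k → s k → s l := fun k l h =>
    hdown (k - l) k l (by have : (l : ℕ) ≤ k := h; omega)
  have hind : ∃ i : Fin n, s i.castSucc ∧ ¬ s i.succ := by
    by_contra! hcon
    obtain ⟨k, hk⟩ := h1
    exact h0 fun l => Fin.induction (hmono k 0 (Fin.zero_le _) hk) hcon l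
  obtain ⟨i, hi, hi'⟩ := hind
  refine ⟨i, fun k => ⟨fun hk => ?_, fun hk => hmono _ _ hk hi⟩⟩
  by_contra hlt
  exact hi' (hmono k i.succ (Fin.castSucc_lt_iff_succ_le.1 (not_le.1 hlt)) hk)

/-- The support of a subchain of a chain with nonzero homomorphisms is an initial segment. -/
theorem IsSubchain.rank_castSucc_ne_zero [ConnectedSpace X]
    [IsManifold 𝓘(ℂ, ℂ) ω X] {C D : Chain X n}
    {ι : ∀ i, Hom (D.E i) (C.E i)} (h : IsSubchain D C ι) (hC : ∀ i, (C.E i).rank = 1)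
    (hφ : ∀ i, C.φ i ≠ 0) {k : Fin n} (hk : (D.E k.succ).rank ≠ 0) :
    (D.E k.castSucc).rank ≠ 0 := by
  intro h0
  have hD : (D.E k.succ).rank = 1 := by
    have := (h.mono k.succ).rank_le_one (hC _)
    omega
  obtain ⟨y, i, hy⟩ := (h.mono k.succ).exists_eventually_ne_zero hD (hC _)
  refine hφ k ((C.φ k).eq_zero_of_eventually (hC _) (hC _) (y := y) ?_)
  filter_upwards [hy] with x ⟨hxD, hxC, hne⟩
  refine (C.φ k).toFun_eq_zero (hC _) hxC ?_
  have h1 := h.comm k x ((D.E k.succ).frame i (lineIndex hD) x)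
  have h2 : (D.φ k).toFun x ((D.E k.succ).frame i (lineIndex hD) x) = 0 :=
    (HolBundle.subsingleton_fiber h0 x).elim _ _
  rw [h2, map_zero, (ι k.succ).map_frame_line hD (hC _) hxC, map_smul] at h1
  exact (smul_eq_zero.1 h1.symm).resolve_left hne

/-- In an `α`-stable chain of line bundles, the proper nonzero truncations which are subchains
have smaller slope. -/
theorem IsStable.slope_truncate_lt [Nonempty X] {C : Chain X n} {α : Fin n → ℝ}
    (hs : C.IsStable α) (hC : ∀ i, (C.E i).rank = 1) {b : Fin (n + 1) → Bool}
    (hb : ∀ k : Fin n, b k.succ = true → b k.castSucc = true ∨ C.φ k = 0)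
    {i j : Fin (n + 1)} (hi : b i = true) (hj : b j = false) :
    (C.truncate b).totalRank > 0 ∧ (C.truncate b).slope α < C.slope α := by
  have hr : ((C.truncate b).E i).rank ≠ 0 := by
    simp [truncate, HolBundle.rank_trunc, hi, hC]
  refine ⟨totalRank_pos hr, hs _ _ (C.isSubchain_truncate hb) ⟨i, hr⟩ fun h => ?_⟩
  have h1 := h j
  have key : ∀ c : Bool, c = false → ¬ (Hom.truncIncl (C.E j) c).IsIso := by
    rintro _ rfl
    exact not_isIso_truncIncl_false (by simp [hC])
  exact key _ hj h1

theorem IsStable.mem_standardCone [Nonempty X] {C : Chain X n} {α : Fin n → ℝ}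
    (hs : C.IsStable α) (hC : ∀ i, (C.E i).rank = 1) : α ∈ C.standardCone := by
  intro i
  rw [standardSubchain_eq]
  refine (hs.slope_truncate_lt hC (i := i.castSucc) (j := i.succ) (fun k hk => Or.inl ?_)
    (by simp) (by simp [Fin.le_def])).2
  simp only [decide_eq_true_eq, Fin.le_def, Fin.val_succ, Fin.val_castSucc] at hk ⊢
  omega

variable [T2Space X] [CompactSpace X] [IsManifold 𝓘(ℂ, ℂ) ω X]

theorem slopeNum_truncate_add (C : Chain X n) (α : Fin n → ℝ) (b : Fin (n + 1) → Bool) :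
    (C.truncate b).slopeNum α + (C.truncate fun k => !b k).slopeNum α = C.slopeNum α := by
  have h1 : ∀ i, ((C.truncate b).E i).degree + ((C.truncate fun k => !b k).E i).degree =
      (C.E i).degree := fun i => by
    simp only [truncate, HolBundle.degree_trunc]
    cases b i <;> simp
  have h2 : ∀ i, (((C.truncate b).E i).rank : ℝ) + (((C.truncate fun k => !b k).E i).rank : ℝ) =
      (C.E i).rank := fun i => by
    simp only [truncate, HolBundle.rank_trunc]
    cases b i <;> simp
  simp only [slopeNum, ← h1, ← h2, Finset.sum_add_distrib, mul_add]
  ring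

theorem IsStable.φ_ne_zero [Nonempty X] {C : Chain X n} {α : Fin n → ℝ}
    (hs : C.IsStable α) (hC : ∀ i, (C.E i).rank = 1) (i : Fin n) : C.φ i ≠ 0 := by
  intro h0
  -- if `φ i = 0`, then `C` is the direct sum of two proper subchains
  set b : Fin (n + 1) → Bool := fun k => decide (k ≤ i.castSucc) with hb
  have hbi : b i.castSucc = true := by simp [hb]
  have hbs : b i.succ = false := by
    simp [hb, Fin.le_def]
  obtain ⟨hp, hlt⟩ := hs.slope_truncate_lt hC (b := b) (fun k hk => Or.inl (by
    simp only [hb, decide_eq_true_eq, Fin.le_def, Fin.val_succ, Fin.val_castSucc] at hk ⊢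
    omega)) hbi hbs
  obtain ⟨hp', hlt'⟩ := hs.slope_truncate_lt hC (b := fun k => !b k) (fun k hk => by
    by_cases hki : k = i
    · exact Or.inr (hki ▸ h0)
    · left
      have : (k : ℕ) ≠ i := fun h => hki (Fin.ext h)
      simp only [hb, Bool.not_eq_true', decide_eq_false_iff_not, Fin.le_def, Fin.val_succ,
        Fin.val_castSucc] at hk ⊢
      omega) (i := i.succ) (j := i.castSucc) (by simp [hbs]) (by simp [hbi])
  have hn := C.slopeNum_truncate_add α b
  have hd := C.totalRank_truncate_add b
  have hpos : 0 < C.totalRank := by linarith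
  rw [slope_eq, slope_eq, div_lt_div_iff₀ hp hpos] at hlt
  rw [slope_eq, slope_eq, div_lt_div_iff₀ hp' hpos] at hlt'
  have := add_lt_add hlt hlt'
  rw [← add_mul, ← mul_add, hn, hd] at this
  exact lt_irrefl _ this

theorem IsSubchain.degree_le {C D : Chain X n} [Nonempty X]
    {ι : ∀ i, Hom (D.E i) (C.E i)} (h : IsSubchain D C ι) (hC : ∀ i, (C.E i).rank = 1)
    (i : Fin (n + 1)) (hi : (D.E i).rank ≠ 0) : (D.E i).degree ≤ (C.E i).degree := by
  have := (h.mono i).rank_le_one (hC _)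
  exact (h.mono i).degree_le (by omega) (hC _)

theorem isStable_of_mem_standardCone [ConnectedSpace X] {C : Chain X n} {α : Fin n → ℝ}
    (hC : ∀ i, (C.E i).rank = 1) (hφ : ∀ i, C.φ i ≠ 0) (hα : α ∈ C.standardCone) :
    C.IsStable α := by
  intro D ι hD hne hiso
  have hle : ∀ i, (D.E i).rank ≤ 1 := fun i => (hD.mono i).rank_le_one (hC i)
  by_cases hall : ∀ i, (D.E i).rank ≠ 0
  · -- `D` has full rank, and some inclusion vanishes in some fiber
    have hr : ∀ i, (D.E i).rank = 1 := fun i => by have := hle i; have := hall i; omega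
    obtain ⟨i, hi⟩ := not_forall.1 hiso
    obtain ⟨p, hp⟩ : ∃ p, (ι i).toFun p = 0 := by
      by_contra! hcon
      exact hi ((ι i).isIso_of_forall_ne_zero (hr i) (hC i) hcon)
    exact slope_lt_slope α (fun k => by rw [hr, hC]) (fun k => hD.degree_le hC k (hall k))
      ((hD.mono i).degree_lt (hr i) (hC i) hp) (by simp [hC])
  · obtain ⟨i, hi⟩ := exists_iff_le_castSucc (s := fun k => (D.E k).rank ≠ 0)
      (fun k hk => hD.rank_castSucc_ne_zero hC hφ hk) hne hall
    refine lt_of_le_of_lt (slope_le_slope α (fun k => ?_) fun k => ?_) (hα i)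
    · simp only [standardSubchain, HolBundle.rank_trunc, hC, decide_eq_true_eq, ← hi k]
      have := hle k
      split_ifs <;> omega
    · simp only [standardSubchain, HolBundle.degree_trunc, decide_eq_true_eq, ← hi k]
      split_ifs with h
      · exact hD.degree_le hC k h
      · exact ((D.E k).degree_eq_zero (not_not.1 h)).le

end Chain

end Chains

end HolomorphicChain

end

theorem proposition3p1 {X : Type*} [TopologicalSpace X] [T2Space X] [CompactSpace X]
    [ConnectedSpace X] [ChartedSpace ℂ X] [IsManifold (modelWithCornersSelf ℂ ℂ) ω X]
    (n : ℕ) (C : HolomorphicChain.Chain X n) (hC : ∀ i, (C.E i).rank = 1) (α : Fin n → ℝ) :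
    C.IsStable α ↔ (∀ i, C.φ i ≠ 0) ∧ α ∈ C.standardCone :=
  ⟨fun hs => ⟨hs.φ_ne_zero hC, hs.mem_standardCone hC⟩,
    fun h => HolomorphicChain.Chain.isStable_of_mem_standardCone hC h.1 h.2⟩
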